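/- Fix $\lambda_v>0$, $\gamma\in(0,1]$, $\lambda_r>0$ and $d>0$. Vehicles on the real line form a homogeneous Poisson point process of intensity $\lambda_v$. Each vehicle is, independently of everything else, V2V capable with probability $\gamma$ and a legacy vehicle otherwise. Road side units (RSUs) are located at $U+m\lambda_r^{-1}$, $m\in\mathbb Z$, where $U$ is uniform on $[0,\lambda_r^{-1}]$ and independent of the vehicles. Two capable vehicles are linked if their distance is at most $d$ and no vehicle lies strictly between them. A cluster is a connected component of the resulting graph on the capable vehicles. A vehicle is in range of an RSU if their distance is at most $d$. For a typical cluster (Palm distribution of the clusters, each counted at its leftmost vehicle), $N$ denotes the number of its vehicles and $M$ the number of RSUs in range of at least one of its vehicles. Let $\pi_v$ be the probability that a typical capable vehicle (Palm distribution of the capable vehicles) has some vehicle of its cluster, possibly itself, in range of an RSU (V2V+V2I network), and let $\pi_v^*$ be the probability that a typical capable vehicle is itself in range of an RSU (V2I-only network). Put $\varphi=1-\gamma\,(1-e^{-\lambda_v d})$. Then $$\pi_v=\varphi^2\sum_{n=1}^{\infty} n\,(1-\varphi)^{n-1}\,P(M\ge 1\mid N=n),$$ and, if $2d\le\lambda_r^{-1}$,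 $$\pi_v^*=\frac{2d}{\lambda_r^{-1}}=2d\lambda_r ,$$ which does not depend on $\lambda_v$. -/

import Mathlib

namespace Highway

open MeasureTheory ProbabilityTheory

/-! ### Geometry of one snapshot of the road

`x k` is the position of vehicle `k`, and `c k` says whether it is V2V capable (`true`) or a
legacy vehicle (`false`). -/

/-- V2V links: two distinct capable vehicles at distance at most `d`, with no vehicle (of either
kind) strictly between them. -/
def linkGraph (d : ℝ) (x : ℤ → ℝ) (c : ℤ → Bool) : SimpleGraph ℤ where
  Adj i j := i ≠ j ∧ c i = true ∧ c j = true ∧ |x i - x j| ≤ d ∧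
    ∀ k, ¬ (min (x i) (x j) < x k ∧ x k < max (x i) (x j))
  symm := ⟨fun i j ⟨h₁, h₂, h₃, h₄, h₅⟩ =>
    ⟨h₁.symm, h₃, h₂, by rwa [abs_sub_comm], by simpa only [min_comm, max_comm] using h₅⟩⟩
  loopless := ⟨fun _ h => h.1 rfl⟩

/-- The relay cluster of vehicle `i`: all vehicles reachable from `i` by a chain of V2V links. -/
def cluster (d : ℝ) (x : ℤ → ℝ) (c : ℤ → Bool) (i : ℤ) : Set ℤ :=
  {j | (linkGraph d x c).Reachable i j}

/-- Vehicle `i` is capable and is the leftmost vehicle of its cluster. Every finite cluster has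
exactly one such vehicle, which serves as the reference point of the cluster. -/
def IsHead (d : ℝ) (x : ℤ → ℝ) (c : ℤ → Bool) (i : ℤ) : Prop :=
  c i = true ∧ ∀ j ∈ cluster d x c i, x i ≤ x j

/-- Position of the `m`-th road side unit: spacing `lamR⁻¹`, offset `u`. -/
noncomputable def rsu (lamR u : ℝ) (m : ℤ) : ℝ := u + m * lamR⁻¹

/-- A vehicle at position `y` is within range `d` of the `m`-th road side unit. -/
def InRange (d lamR u y : ℝ) (m : ℤ) : Prop := |y - rsu lamR u m| ≤ d

/-- `N`: the number of vehicles in the cluster of vehicle `i`. -/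
noncomputable def numVehicles (d : ℝ) (x : ℤ → ℝ) (c : ℤ → Bool) (i : ℤ) : ℕ∞ :=
  (cluster d x c i).encard

/-- `M`: the number of road side units in range of some vehicle of the cluster of vehicle `i`. -/
noncomputable def numRSU (d lamR : ℝ) (x : ℤ → ℝ) (c : ℤ → Bool) (u : ℝ) (i : ℤ) : ℕ∞ :=
  {m : ℤ | ∃ j ∈ cluster d x c i, InRange d lamR u (x j) m}.encard

/-- Coverage with relaying: vehicle `i` reaches some road side unit, directly or through a chain of
V2V links. -/
def CoveredV2V (d lamR : ℝ) (x : ℤ → ℝ) (c : ℤ → Bool) (u : ℝ) (i : ℤ) : Prop :=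
  ∃ j, (linkGraph d x c).Reachable i j ∧ ∃ m, InRange d lamR u (x j) m

/-- Coverage without relaying: vehicle `i` is itself in range of some road side unit. -/
def CoveredV2I (d lamR : ℝ) (x : ℤ → ℝ) (u : ℝ) (i : ℤ) : Prop :=
  ∃ m, InRange d lamR u (x i) m

/-! ### The random model -/

variable {Ω : Type*} [MeasurableSpace Ω]

/-- `X` lists, from left to right, the points of a homogeneous Poisson point process on `ℝ` of
intensity `lam`: the numbers of points in disjoint Borel sets of finite length are independent, and
Poisson distributed with mean `lam` times the length. -/
structure IsPoissonProcess (P : Measure Ω) (X : ℤ → Ω → ℝ) (lam : ℝ) : Prop where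
  measurable : ∀ k, Measurable (X k)
  strictMono : ∀ᵐ ω ∂P, StrictMono fun k => X k ω
  counts : ∀ (m : ℕ) (B : Fin m → Set ℝ), (∀ i, MeasurableSet (B i)) →
    (∀ i, volume (B i) ≠ ⊤) → Pairwise (Function.onFun Disjoint B) → ∀ n : Fin m → ℕ,
      P {ω | ∀ i, {k : ℤ | X k ω ∈ B i}.encard = (n i : ℕ∞)} =
        ∏ i, poissonMeasure (lam * volume.real (B i)).toNNReal {n i}

/-- The single-lane highway: Poisson vehicle positions `X` of intensity `lamV`, each vehicle being
V2V capable (`C k ω = true`) with probability `γ` independently of everything else, and an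
independent grid of road side units with spacing `lamR⁻¹` and uniformly distributed offset `U`. -/
structure IsHighway (P : Measure Ω) (X : ℤ → Ω → ℝ) (C : ℤ → Ω → Bool) (U : Ω → ℝ)
    (lamV γ lamR : ℝ) : Prop where
  poisson : IsPoissonProcess P X lamV
  measurable_mark : ∀ k, Measurable (C k)
  mark_prob : ∀ k, P {ω | C k ω = true} = ENNReal.ofReal γ
  mark_indep : iIndepFun C P
  measurable_offset : Measurable U
  offset_uniform : pdf.IsUniform U (Set.Icc 0 lamR⁻¹) P
  indep_pos_mark : IndepFun (fun ω k => X k ω) (fun ω k => C k ω) P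
  indep_offset : IndepFun (fun ω => ((fun k => X k ω), (fun k => C k ω))) U P

/-- The Palm distribution of a typical (V2V capable) vehicle. It is a law on pairs
(outcome, label of the typical vehicle): an event `A` has probability
`E #{k capable, X k ∈ W, (·, k) ∈ A} / E #{k capable, X k ∈ W}`, where `W` is a window. -/
noncomputable def typicalVehicle (P : Measure Ω) (X : ℤ → Ω → ℝ) (C : ℤ → Ω → Bool)
    (W : Set ℝ) : Measure (Ω × ℤ) :=
  ProbabilityTheory.cond (P.prod Measure.count)
    {p : Ω × ℤ | C p.2 p.1 = true ∧ X p.2 p.1 ∈ W}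

/-- The Palm distribution of a typical cluster, a law on pairs (outcome, label of the leftmost
vehicle of the typical cluster); each cluster is counted at its leftmost vehicle. -/
noncomputable def typicalCluster (P : Measure Ω) (X : ℤ → Ω → ℝ) (C : ℤ → Ω → Bool) (d : ℝ)
    (W : Set ℝ) : Measure (Ω × ℤ) :=
  ProbabilityTheory.cond (P.prod Measure.count)
    {p : Ω × ℤ | IsHead d (fun k => X k p.1) (fun k => C k p.1) p.2 ∧ X p.2 p.1 ∈ W}

/-- `π_v`: probability that a typical vehicle is covered when vehicles relay. -/
noncomputable def coverageV2V (P : Measure Ω) (X : ℤ → Ω → ℝ) (C : ℤ → Ω → Bool) (U : Ω → ℝ)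
    (d lamR : ℝ) (W : Set ℝ) : ℝ :=
  (typicalVehicle P X C W).real
    {p | CoveredV2V d lamR (fun k => X k p.1) (fun k => C k p.1) (U p.1) p.2}

/-- `π_v*`: probability that a typical vehicle is covered without relaying. -/
noncomputable def coverageV2I (P : Measure Ω) (X : ℤ → Ω → ℝ) (C : ℤ → Ω → Bool) (U : Ω → ℝ)
    (d lamR : ℝ) (W : Set ℝ) : ℝ :=
  (typicalVehicle P X C W).real
    {p | CoveredV2I d lamR (fun k => X k p.1) (U p.1) p.2}

/-- `P(M ≥ 1 | N = n)` for the typical cluster. -/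
noncomputable def clusterCoverage (P : Measure Ω) (X : ℤ → Ω → ℝ) (C : ℤ → Ω → Bool) (U : Ω → ℝ)
    (d lamR : ℝ) (W : Set ℝ) (n : ℕ) : ℝ :=
  (ProbabilityTheory.cond (typicalCluster P X C d W)
    {p | numVehicles d (fun k => X k p.1) (fun k => C k p.1) p.2 = (n : ℕ∞)}).real
    {p | 1 ≤ numRSU d lamR (fun k => X k p.1) (fun k => C k p.1) (U p.1) p.2}

/-- `φ = 1 - γ (1 - exp (-λ_v d))`. -/
noncomputable def phi (lamV γ d : ℝ) : ℝ := 1 - γ * (1 - Real.exp (-(lamV * d)))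

end Highway

/-!
The count of vehicles with a given local picture is governed by the Palm distribution of the Poisson
process: in mean over the vehicles, position, gaps to the right, marks and offset are independent,
the position having intensity `lamV • volume`, the gaps being i.i.d. exponential, the marks i.i.d.
Bernoulli (`sum_map_position_gaps`, `sum_map_localData`). For the gaps this is proved by cutting the
line into cells of width `1 / N`: occupied cells form a Bernoulli sequence, whose index gaps are
i.i.d. geometric (`measure_chain`), and as `N → ∞` the number of cells starting a prescribed pattern
of index gaps is eventually the number of points starting the corresponding pattern of gaps
(`eventually_encard_windowChains`), with domination by the number of points in a window.

Consequently the mean number of vehicles in a window `W`, whose `i`-th vehicle to the left sees a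
translation-invariant event, is `lamV * volume W` times a constant free of both `W` and `i`
(`measure_localData_window`): integrating the position out first removes the window, and the uniform
offset of the periodic grid of road side units absorbs the translation.

Clusters are maximal runs of consecutive linked vehicles. A vehicle is the left neighbour of a run
of `n` vehicles with probability `γ (1 - φ) ^ (n - 1) φ²` (`measureReal_runSet`). Counting the
vehicles of a run at its head or at any of its `n` places gives the same intensity, so a typical
vehicle lies in a covered cluster of size `n` with `n` times the intensity of covered heads
(`measure_coveredV2V`), and dividing by the run probability turns the latter into `P(M ≥ 1 | N =
n)` (`clusterCoverage_eq`). Infinite clusters do not contribute: `n γ (1 - φ) ^ (n - 1) φ²`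
already sums to `γ` (`hasSum_runSet`).
-/

namespace Highway

open MeasureTheory ProbabilityTheory Set Filter Topology
open scoped ENNReal

/-! ### Sequences of occupied and empty sites -/

/-- `chain O L s i`: site `i` is occupied, and the next `L` occupied sites to its right exist and
have successive index differences exceeding `s 0, s 1, …, s (L - 1)`. -/
def chain (O : ℤ → Prop) : ℕ → (ℕ → ℕ) → ℤ → Prop
  | 0, _, i => O i
  | L + 1, s, i => O i ∧ ∃ n : ℕ, (∀ j, i < j → j < i + s 0 + 1 + n → ¬ O j) ∧
      chain O L (fun j => s (j + 1)) (i + s 0 + 1 + n)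

lemma chain.head {O : ℤ → Prop} {L : ℕ} {s : ℕ → ℕ} {i : ℤ} (h : chain O L s i) : O i := by
  cases L with
  | zero => exact h
  | succ L => exact h.1

/-- For sites occupied by a monotone sequence whose relevant steps are strict, the occupied site
following `y k` is `y (k + 1)`. -/
lemma chain_range_iff {y : ℤ → ℤ} (hy : Monotone y) (L : ℕ) (s : ℕ → ℕ) (k : ℤ)
    (hk : ∀ j < L, y (k + j) < y (k + j + 1)) :
    chain (fun i => ∃ m, y m = i) L s (y k) ↔ ∀ j < L, y (k + j) + s j < y (k + j + 1) := by
  induction L generalizing s k with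
  | zero => simp [chain]
  | succ L ih =>
    have h0 : y k < y (k + 1) := by simpa using hk 0 (by omega)
    have hk' : ∀ j < L, y (k + 1 + j) < y (k + 1 + j + 1) := by
      intro j hj
      have := hk (j + 1) (by omega)
      push_cast at this
      rwa [show k + (j + 1 : ℤ) = k + 1 + j by ring] at this
    have step := ih (fun j => s (j + 1)) (k + 1) hk'
    have empty : ∀ j, y k < j → j < y (k + 1) → ¬ ∃ m, y m = j := by
      rintro j h1 h2 ⟨m, rfl⟩
      rcases le_or_gt m k with h | h
      · exact absurd (hy h) (by omega)
      · exact absurd (hy (show k + 1 ≤ m by omega)) (by omega)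
    have split : (∀ j < L + 1, y (k + j) + s j < y (k + j + 1)) ↔
        y k + s 0 < y (k + 1) ∧ ∀ j < L, y (k + 1 + j) + s (j + 1) < y (k + 1 + j + 1) := by
      constructor
      · intro h
        refine ⟨by simpa using h 0 (by omega), fun j hj => ?_⟩
        have := h (j + 1) (by omega)
        push_cast at this
        rwa [show k + (j + 1 : ℤ) = k + 1 + j by ring] at this
      · rintro ⟨h1, h2⟩ j hj
        cases j with
        | zero => simpa using h1
        | succ j =>
          have := h2 j (by omega)
          push_cast
          rwa [show k + (j + 1 : ℤ) = k + 1 + j by ring]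
    rw [split]
    constructor
    · rintro ⟨_, n, hn, hc⟩
      have hocc : ∃ m, y m = y k + s 0 + 1 + n := hc.head
      have e : y k + s 0 + 1 + n = y (k + 1) := by
        rcases lt_trichotomy (y k + s 0 + 1 + n) (y (k + 1)) with h | h | h
        · exact absurd hocc (empty _ (by omega) h)
        · exact h
        · exact absurd ⟨k + 1, rfl⟩ (hn _ h0 h)
      rw [e] at hc
      exact ⟨by omega, step.1 hc⟩
    · rintro ⟨h1, h2⟩
      have e : y k + s 0 + 1 + ((y (k + 1) - (y k + s 0 + 1)).toNat : ℤ) = y (k + 1) := by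
        rw [Int.toNat_of_nonneg (by omega)]; ring
      refine ⟨⟨k, rfl⟩, (y (k + 1) - (y k + s 0 + 1)).toNat, ?_, ?_⟩
      · rw [e]; exact empty
      · rw [e]; exact step.2 h2

section Bernoulli

variable {Ω : Type*}

/-- `chain` from `i` depends only on the sites at or to the right of `i`. -/
lemma measurableSet_chain (E : ℤ → Set Ω) (L : ℕ) (s : ℕ → ℕ) (i : ℤ) :
    MeasurableSet[⨆ j ∈ Ici i, MeasurableSpace.generateFrom {E j}]
      {ω | chain (fun j => ω ∉ E j) L s i} := by
  have site : ∀ {a b : ℤ}, a ≤ b →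
      MeasurableSet[⨆ j ∈ Ici a, MeasurableSpace.generateFrom {E j}] (E b) := by
    intro a b hab
    exact (le_iSup₂_of_le (f := fun j (_ : j ∈ Ici a) => MeasurableSpace.generateFrom {E j})
      b hab le_rfl) _ (MeasurableSpace.measurableSet_generateFrom rfl)
  induction L generalizing s i with
  | zero => exact (site le_rfl).compl
  | succ L ih =>
    simp only [chain, ofPred_and, ofPred_exists, ofPred_forall, not_not]
    refine MeasurableSet.inter (site le_rfl).compl (MeasurableSet.iUnion fun n => ?_)
    refine MeasurableSet.inter ?_ ?_
    · refine MeasurableSet.iInter fun j => MeasurableSet.iInter fun hj =>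
        MeasurableSet.iInter fun _ => site hj.le
    · refine (biSup_mono ?_ :
        (⨆ j ∈ Ici (i + s 0 + 1 + n), MeasurableSpace.generateFrom {E j}) ≤ _) _ (ih _ _)
      intro j hj
      simp only [mem_Ici] at hj ⊢
      omega

variable [mΩ : MeasurableSpace Ω] {P : Measure Ω} {E : ℤ → Set Ω}

lemma measurableSet_chain' (hE : ∀ j, MeasurableSet (E j)) (L : ℕ) (s : ℕ → ℕ) (i : ℤ) :
    MeasurableSet {ω | chain (fun j => ω ∉ E j) L s i} := by
  refine (iSup₂_le fun j _ => ?_ :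
    (⨆ j ∈ Ici i, MeasurableSpace.generateFrom {E j}) ≤ mΩ) _ (measurableSet_chain E L s i)
  exact MeasurableSpace.generateFrom_le (by simpa using hE j)

/-- In a sequence of independent sites, each empty with probability `r`, the index differences of
successive occupied sites are independent and geometric. -/
lemma measure_chain [IsProbabilityMeasure P] (hE : ∀ j, MeasurableSet (E j)) (hind : iIndepSet E P)
    {r : ℝ≥0∞} (hr : r < 1) (hPr : ∀ j, P (E j) = r) (L : ℕ) (s : ℕ → ℕ) (i : ℤ) :
    P {ω | chain (fun j => ω ∉ E j) L s i} = (1 - r) * ∏ j ∈ Finset.range L, r ^ s j := by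
  have hcompl : ∀ j, P (E j)ᶜ = 1 - r := fun j => by
    rw [prob_compl_eq_one_sub (hE j), hPr j]
  induction L generalizing s i with
  | zero => simp only [chain, Finset.range_zero, Finset.prod_empty, mul_one]; exact hcompl i
  | succ L ih =>
    set F : ℕ → Set Ω := fun n => {ω | ω ∉ E i ∧ ∀ j, i < j → j < i + s 0 + 1 + n → ω ∈ E j} with hF
    set G : ℕ → Set Ω := fun n =>
      {ω | chain (fun j => ω ∉ E j) L (fun j => s (j + 1)) (i + s 0 + 1 + n)} with hG
    have hFi : ∀ n, F n = ⋂ j ∈ Finset.Ico i (i + s 0 + 1 + n), if j = i then (E j)ᶜ else E j := by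
      intro n
      ext ω
      simp only [hF, mem_ofPred_eq, mem_iInter, Finset.mem_Ico]
      constructor
      · rintro ⟨h1, h2⟩ j ⟨h3, h4⟩
        by_cases e : j = i
        · simpa [e] using h1
        · simpa [e] using h2 j (by omega) h4
      · intro h
        refine ⟨by simpa using h i ⟨le_rfl, by omega⟩, fun j h1 h2 => ?_⟩
        simpa [h1.ne'] using h j ⟨h1.le, h2⟩
    have hFm : ∀ n, MeasurableSet (F n) := fun n => by
      rw [hFi n]
      refine Finset.measurableSet_biInter _ fun j _ => ?_
      split_ifs
      exacts [(hE j).compl, hE j]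
    have hFP : ∀ n, P (F n) = (1 - r) * (r ^ s 0 * r ^ n) := fun n => by
      have hI : iIndep (fun j => MeasurableSpace.generateFrom {E j}) P := hind
      rw [hFi n, hI.meas_biInter]
      · have hmem : i ∈ Finset.Ico i (i + s 0 + 1 + n) := by
          rw [Finset.mem_Ico]; omega
        rw [← Finset.mul_prod_erase _ _ hmem, if_pos rfl, hcompl, Finset.prod_congr rfl
          (g := fun _ => r)]
        · rw [Finset.prod_const, Finset.card_erase_of_mem hmem, Int.card_Ico, ← pow_add]
          congr 2
          omega
        · intro j hj
          rw [if_neg (Finset.ne_of_mem_erase hj), hPr]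
      · intro j _
        have := MeasurableSpace.measurableSet_generateFrom (mem_singleton (E j))
        split_ifs
        exacts [this.compl, this]
    have hFG : ∀ n, P (F n ∩ G n) = P (F n) * P (G n) := fun n => by
      have hdisj : Disjoint (Iio (i + s 0 + 1 + n : ℤ)) (Ici (i + s 0 + 1 + n)) :=
        Set.disjoint_left.2 fun a ha hb => (not_lt.2 (mem_Ici.1 hb)) (mem_Iio.1 ha)
      have hI := indep_iSup_of_disjoint
        (fun j => MeasurableSpace.generateFrom_le (by simpa using hE j)) hind hdisj
      refine Indep_iff _ _ _ |>.1 hI _ _ ?_ (measurableSet_chain E L _ _)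
      have site : ∀ {b : ℤ}, b < i + s 0 + 1 + n → MeasurableSet[⨆ j ∈ Iio (i + s 0 + 1 + n : ℤ),
          MeasurableSpace.generateFrom {E j}] (E b) := by
        intro b hab
        exact (le_iSup₂_of_le (f := fun j (_ : j ∈ Iio (i + s 0 + 1 + n : ℤ)) =>
          MeasurableSpace.generateFrom {E j})
          b hab le_rfl) _ (MeasurableSpace.measurableSet_generateFrom rfl)
      rw [hFi n]
      refine Finset.measurableSet_biInter _ fun j hj => ?_
      rw [Finset.mem_Ico] at hj
      split_ifs
      exacts [(site hj.2).compl, site hj.2]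
    have hU : {ω | chain (fun j => ω ∉ E j) (L + 1) s i} = ⋃ n, F n ∩ G n := by
      ext ω
      simp only [chain, hF, hG, mem_ofPred_eq, mem_iUnion, mem_inter_iff, not_not]
      constructor
      · rintro ⟨h1, n, h2, h3⟩
        exact ⟨n, ⟨h1, h2⟩, h3⟩
      · rintro ⟨n, ⟨h1, h2⟩, h3⟩
        exact ⟨h1, n, h2, h3⟩
    have hd : ∀ m n, m < n → Disjoint (F m ∩ G m) (F n ∩ G n) := by
      intro m n hmn
      refine Set.disjoint_left.2 ?_
      rintro ω ⟨_, hm⟩ ⟨hn, _⟩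
      exact hm.head (hn.2 _ (by omega) (by omega))
    have hpair : Pairwise (Function.onFun Disjoint fun n => F n ∩ G n) := fun m n hmn => by
      rcases lt_or_gt_of_ne hmn with h | h
      exacts [hd _ _ h, (hd _ _ h).symm]
    have hterm : ∀ n, P (F n ∩ G n) = (1 - r) * (r ^ s 0 * r ^ n) *
        ((1 - r) * ∏ j ∈ Finset.range L, r ^ s (j + 1)) := fun n => by
      rw [hFG, hFP, hG, ih]
    rw [hU, measure_iUnion hpair fun n => (hFm n).inter (measurableSet_chain' hE _ _ _),
      tsum_congr hterm, ENNReal.tsum_mul_right, ENNReal.tsum_mul_left, ENNReal.tsum_mul_left,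
      ENNReal.tsum_geometric, Finset.prod_range_succ' _ L]
    have h1 : (1 - r) * (1 - r)⁻¹ = 1 :=
      ENNReal.mul_inv_cancel (tsub_pos_of_lt hr).ne' (by finiteness)
    calc (1 - r) * (r ^ s 0 * (1 - r)⁻¹) * ((1 - r) * ∏ j ∈ Finset.range L, r ^ s (j + 1))
        = ((1 - r) * (1 - r)⁻¹) *
          ((1 - r) * ((∏ j ∈ Finset.range L, r ^ s (j + 1)) * r ^ s 0)) := by ring
      _ = _ := by rw [h1, one_mul]

end Bernoulli

/-! ### Discretizing a point configuration -/

lemma eventually_floor_add_ceil_lt_iff (y z t : ℝ) (hyz : y < z) :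
    ∀ᶠ N : ℕ in atTop, (⌊y * N⌋ + (⌈t * N⌉₊ : ℤ) < ⌊z * N⌋ ↔ t < z - y) := by
  rcases lt_or_ge t (z - y) with h | h
  · have hpos : 0 < z - y - max t 0 := by
      have : max t 0 < z - y := max_lt h (by linarith)
      linarith
    have htend : Tendsto (fun N : ℕ => (z - y - max t 0) * (N : ℝ)) atTop atTop :=
      tendsto_natCast_atTop_atTop.const_mul_atTop hpos
    filter_upwards [htend.eventually_ge_atTop 2] with N hN
    refine iff_of_true ?_ h
    have h1 : (⌊y * N⌋ : ℝ) ≤ y * N := Int.floor_le _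
    have h2 : z * N < ⌊z * N⌋ + 1 := Int.lt_floor_add_one _
    have h3 : (⌈t * N⌉₊ : ℝ) < max t 0 * N + 1 := by
      refine lt_of_le_of_lt ?_ (Nat.ceil_lt_add_one (by positivity : 0 ≤ max t 0 * N))
      exact_mod_cast Nat.ceil_mono (mul_le_mul_of_nonneg_right (le_max_left t 0) N.cast_nonneg)
    have : ((⌊y * N⌋ + (⌈t * N⌉₊ : ℤ) : ℤ) : ℝ) < (⌊z * N⌋ : ℤ) := by
      push_cast
      linarith
    exact_mod_cast this
  · refine Eventually.of_forall fun N => iff_of_false ?_ (not_lt.2 h)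
    have h1 : y * N < ⌊y * N⌋ + 1 := Int.lt_floor_add_one _
    have h2 : (⌊z * N⌋ : ℝ) ≤ z * N := Int.floor_le _
    have h3 : t * N ≤ ⌈t * N⌉₊ := Nat.le_ceil _
    have h4 : (z - y) * N ≤ t * N := mul_le_mul_of_nonneg_right h N.cast_nonneg
    have : ((⌊z * N⌋ : ℤ) : ℝ) < ((⌊y * N⌋ + (⌈t * N⌉₊ : ℤ) + 1 : ℤ) : ℝ) := by
      push_cast
      linarith
    have : ⌊z * N⌋ < ⌊y * N⌋ + (⌈t * N⌉₊ : ℤ) + 1 := by exact_mod_cast this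
    omega

lemma eventually_floor_lt_floor {y z : ℝ} (hyz : y < z) :
    ∀ᶠ N : ℕ in atTop, ⌊y * N⌋ < ⌊z * N⌋ := by
  filter_upwards [eventually_floor_add_ceil_lt_iff y z 0 hyz] with N hN
  simpa using hN.2 (by linarith)

lemma eventually_floor_le_floor_iff (y z : ℝ) :
    ∀ᶠ N : ℕ in atTop, (⌊y * N⌋ ≤ ⌊z * N⌋ ↔ y ≤ z) := by
  rcases le_or_gt y z with h | h
  · exact Eventually.of_forall fun N =>
      iff_of_true (Int.floor_mono (mul_le_mul_of_nonneg_right h N.cast_nonneg)) h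
  · filter_upwards [eventually_floor_lt_floor h] with N hN
    exact iff_of_false (not_le.2 hN) (not_le.2 h)

/-- The cells of width `1 / N` in the window `[a, b)` from which the next `L` occupied cells are
more than `t 0, …, t (L - 1)` apart, when the points are `x k`. -/
def windowChains (x : ℤ → ℝ) (a b : ℝ) (L : ℕ) (t : ℕ → ℝ) (N : ℕ) : Set ℤ :=
  {i | (⌊a * N⌋ ≤ i ∧ i < ⌊b * N⌋) ∧ chain (fun i => ∃ m, ⌊x m * N⌋ = i) L (fun j => ⌈t j * N⌉₊) i}

/-- The points in the window `[a, b)` followed by `L` gaps longer than `t 0, …, t (L - 1)`. -/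
def windowPoints (x : ℤ → ℝ) (a b : ℝ) (L : ℕ) (t : ℕ → ℝ) : Set ℤ :=
  {k | (a ≤ x k ∧ x k < b) ∧ ∀ j < L, t j < x (k + j + 1) - x (k + j)}

lemma mem_window_of_floor {x a b : ℝ} {N : ℕ} (hN : 1 ≤ N) (h1 : ⌊a * N⌋ ≤ ⌊x * N⌋)
    (h2 : ⌊x * N⌋ < ⌊b * N⌋) : a - 1 ≤ x ∧ x < b := by
  have hN' : (1 : ℝ) ≤ N := by exact_mod_cast hN
  constructor
  · by_contra! h
    have h3 : a * N < ⌊a * N⌋ + 1 := Int.lt_floor_add_one _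
    have h4 : (⌊x * N⌋ : ℝ) ≤ x * N := Int.floor_le _
    have h5 : (⌊a * N⌋ : ℝ) ≤ ⌊x * N⌋ := by exact_mod_cast h1
    nlinarith
  · by_contra! h
    exact absurd (Int.floor_mono (mul_le_mul_of_nonneg_right h N.cast_nonneg)) (not_le.2 h2)

lemma encard_windowChains_le (x : ℤ → ℝ) (a b : ℝ) (L : ℕ) (t : ℕ → ℝ) {N : ℕ} (hN : 1 ≤ N) :
    (windowChains x a b L t N).encard ≤ (windowPoints x (a - 1) b 0 t).encard := by
  refine le_trans (encard_le_encard ?_) (encard_image_le (fun k => ⌊x k * N⌋) _)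
  rintro i ⟨⟨h1, h2⟩, h3⟩
  obtain ⟨m, rfl⟩ := h3.head
  exact ⟨m, ⟨mem_window_of_floor hN h1 h2, by simp⟩, rfl⟩

/-- Once the cells are narrow enough, every point of the window lies in a cell of its own, and the
discretized gap conditions agree with the original ones. -/
lemma eventually_encard_windowChains {x : ℤ → ℝ} (hx : StrictMono x)
    (hfin : ∀ a b, {k | a ≤ x k ∧ x k < b}.Finite) (a b : ℝ) (L : ℕ) (t : ℕ → ℝ) :
    ∀ᶠ N : ℕ in atTop, (windowChains x a b L t N).encard = (windowPoints x a b L t).encard := by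
  set K := {k | a - 1 ≤ x k ∧ x k < b} with hK
  have hKfin : K.Finite := hfin _ _
  have e1 : ∀ᶠ N : ℕ in atTop, ∀ k ∈ K, ∀ j ∈ Iio (L + 1),
      ⌊x (k + (j : ℕ)) * N⌋ < ⌊x (k + j + 1) * N⌋ := by
    rw [eventually_all_finite hKfin]
    intro k _
    rw [eventually_all_finite (finite_Iio _)]
    intro j _
    exact eventually_floor_lt_floor (hx (by omega))
  have e2 : ∀ᶠ N : ℕ in atTop, ∀ k ∈ K, ∀ j ∈ Iio L,
      (⌊x (k + (j : ℕ)) * N⌋ + (⌈t j * N⌉₊ : ℤ) < ⌊x (k + j + 1) * N⌋ ↔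
        t j < x (k + j + 1) - x (k + j)) := by
    rw [eventually_all_finite hKfin]
    intro k _
    rw [eventually_all_finite (finite_Iio _)]
    intro j _
    exact eventually_floor_add_ceil_lt_iff _ _ _ (hx (by omega))
  have e3 : ∀ᶠ N : ℕ in atTop, ∀ k ∈ K, (⌊a * N⌋ ≤ ⌊x k * N⌋ ↔ a ≤ x k) := by
    rw [eventually_all_finite hKfin]
    exact fun k _ => eventually_floor_le_floor_iff _ _
  have e4 : ∀ᶠ N : ℕ in atTop, ∀ k ∈ K, (⌊b * N⌋ ≤ ⌊x k * N⌋ ↔ b ≤ x k) := by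
    rw [eventually_all_finite hKfin]
    exact fun k _ => eventually_floor_le_floor_iff _ _
  filter_upwards [e1, e2, e3, e4, eventually_ge_atTop 1] with N h1 h2 h3 h4 hN
  have hmono : Monotone fun k => ⌊x k * N⌋ := fun k l hkl =>
    Int.floor_mono (mul_le_mul_of_nonneg_right (hx.monotone hkl) N.cast_nonneg)
  have hch : ∀ k ∈ K, (chain (fun i => ∃ m, ⌊x m * N⌋ = i) L (fun j => ⌈t j * N⌉₊) ⌊x k * N⌋ ↔
      ∀ j < L, t j < x (k + j + 1) - x (k + j)) := by
    intro k hk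
    rw [chain_range_iff hmono L _ k fun j hj => h1 k hk j (by simp; omega)]
    exact forall₂_congr fun j hj => h2 k hk j hj
  have himg : windowChains x a b L t N = (fun k => ⌊x k * N⌋) '' windowPoints x a b L t := by
    ext i
    constructor
    · rintro ⟨⟨h5, h6⟩, h7⟩
      obtain ⟨m, rfl⟩ := h7.head
      have hm : m ∈ K := mem_window_of_floor hN h5 h6
      exact ⟨m, ⟨⟨(h3 m hm).1 h5, hm.2⟩, (hch m hm).1 h7⟩, rfl⟩
    · rintro ⟨k, ⟨⟨h5, h6⟩, h7⟩, rfl⟩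
      have hk : k ∈ K := ⟨by linarith, h6⟩
      exact ⟨⟨(h3 k hk).2 h5, not_le.1 fun h => absurd ((h4 k hk).1 h) (not_le.2 h6)⟩,
        (hch k hk).2 h7⟩
  rw [himg, InjOn.encard_image]
  intro k hk l hl hkl
  have hk' : k ∈ K := ⟨by linarith [hk.1.1], hk.1.2⟩
  have hl' : l ∈ K := ⟨by linarith [hl.1.1], hl.1.2⟩
  have hlt : ∀ {k l}, k ∈ K → k < l → ⌊x k * N⌋ < ⌊x l * N⌋ := by
    intro k l hk hkl
    have := h1 k hk 0 (by simp)
    simp only [Nat.cast_zero, add_zero] at this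
    exact this.trans_le (hmono (by omega))
  rcases lt_trichotomy k l with h | h | h
  · exact absurd hkl (hlt hk' h).ne
  · exact h
  · exact absurd hkl (hlt hl' h).ne'

/-! ### Cells of a Poisson process -/

section

variable {Ω : Type*} [MeasurableSpace Ω] {P : Measure Ω} {X : ℤ → Ω → ℝ} {lam : ℝ}

/-- The event that the `i`-th cell of width `1 / N` contains no point. -/
def emptyCell (X : ℤ → Ω → ℝ) (N : ℕ) (i : ℤ) : Set Ω := {ω | ∀ k, ⌊X k ω * N⌋ ≠ i}

lemma IsPoissonProcess.measurableSet_emptyCell (h : IsPoissonProcess P X lam) (N : ℕ) (i : ℤ) :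
    MeasurableSet (emptyCell X N i) := by
  have hm : ∀ k, Measurable fun ω => ⌊X k ω * N⌋ := fun k =>
    Int.measurable_floor.comp ((h.measurable k).mul_const _)
  rw [emptyCell, ofPred_forall]
  exact MeasurableSet.iInter fun k => (hm k (measurableSet_singleton i)).compl

lemma floor_mul_eq_iff {N : ℕ} (hN : 1 ≤ N) (i : ℤ) :
    {y : ℝ | ⌊y * N⌋ = i} = Ico ((i : ℝ) / N) ((i + 1 : ℝ) / N) := by
  have hN' : (0 : ℝ) < N := by exact_mod_cast hN
  ext y
  rw [mem_ofPred_eq, Int.floor_eq_iff, mem_Ico, div_le_iff₀ hN', lt_div_iff₀ hN']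

lemma IsPoissonProcess.measure_iInter_emptyCell (h : IsPoissonProcess P X lam) (hlam : 0 < lam)
    {N : ℕ} (hN : 1 ≤ N) (S : Finset ℤ) :
    P (⋂ i ∈ S, emptyCell X N i) = ENNReal.ofReal (Real.exp (-(lam / N))) ^ S.card := by
  have hN' : (0 : ℝ) < N := by exact_mod_cast hN
  set e := S.equivFin.symm
  have hvol : ∀ i : ℤ, volume {y : ℝ | ⌊y * N⌋ = i} = ENNReal.ofReal (1 / N) := fun i => by
    rw [floor_mul_eq_iff hN, Real.volume_Ico]
    congr 1
    ring
  have hc := h.counts S.card (fun j => {y : ℝ | ⌊y * N⌋ = (e j : ℤ)})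
    (fun j => by rw [floor_mul_eq_iff hN]; exact measurableSet_Ico)
    (fun j => by rw [hvol]; exact ENNReal.ofReal_ne_top)
    (fun j l hjl => Set.disjoint_left.2 fun y hy hy' =>
      hjl (e.injective (Subtype.ext (hy.symm.trans hy')))) (fun _ => 0)
  have hset : (⋂ i ∈ S, emptyCell X N i) =
      {ω | ∀ j : Fin S.card, {k : ℤ | X k ω ∈ {y : ℝ | ⌊y * N⌋ = (e j : ℤ)}}.encard
        = ((0 : ℕ) : ℕ∞)} := by
    ext ω
    simp only [emptyCell, mem_iInter, mem_ofPred_eq, Nat.cast_zero, encard_eq_zero,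
      eq_empty_iff_forall_notMem]
    constructor
    · exact fun H j k => H _ (e j).2 k
    · intro H i hi k
      have := H (e.symm ⟨i, hi⟩) k
      simpa using this
  rw [hset, hc]
  have : ∀ j : Fin S.card, poissonMeasure
      (lam * volume.real {y : ℝ | ⌊y * N⌋ = (e j : ℤ)}).toNNReal {0} =
      ENNReal.ofReal (Real.exp (-(lam / N))) := fun j => by
    rw [poissonMeasure_singleton, measureReal_def, hvol, ENNReal.toReal_ofReal (by positivity),
      Real.coe_toNNReal _ (by positivity)]
    simp [div_eq_mul_inv]
  simp [this]

lemma IsPoissonProcess.measure_emptyCell (h : IsPoissonProcess P X lam) (hlam : 0 < lam)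
    {N : ℕ} (hN : 1 ≤ N) (i : ℤ) :
    P (emptyCell X N i) = ENNReal.ofReal (Real.exp (-(lam / N))) := by
  simpa using h.measure_iInter_emptyCell hlam hN {i}

lemma IsPoissonProcess.iIndepSet_emptyCell [IsProbabilityMeasure P] (h : IsPoissonProcess P X lam)
    (hlam : 0 < lam) {N : ℕ} (hN : 1 ≤ N) : iIndepSet (emptyCell X N) P := by
  rw [iIndepSet_iff_meas_biInter (h.measurableSet_emptyCell N)]
  intro S
  rw [h.measure_iInter_emptyCell hlam hN, Finset.prod_congr rfl fun i _ =>
    h.measure_emptyCell hlam hN i, Finset.prod_const]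

lemma IsPoissonProcess.ae_finite_window [IsProbabilityMeasure P] (h : IsPoissonProcess P X lam) :
    ∀ᵐ ω ∂P, ∀ a b, {k | a ≤ X k ω ∧ X k ω < b}.Finite := by
  have key : ∀ M : ℕ, ∀ᵐ ω ∂P, {k | X k ω ∈ Ico (-(M : ℝ)) M}.Finite := by
    intro M
    set c : Ω → ℝ≥0∞ := fun ω => Measure.count {k | X k ω ∈ Ico (-(M : ℝ)) M} with hc
    have hset : MeasurableSet {p : Ω × ℤ | X p.2 p.1 ∈ Ico (-(M : ℝ)) M} :=
      measurableSet_Ico.preimage (measurable_from_prod_countable_left fun k => h.measurable k)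
    have hcm : Measurable c := measurable_measure_prodMk_left hset
    set A : ℕ → Set Ω := fun n => {ω | {k : ℤ | X k ω ∈ Ico (-(M : ℝ)) M}.encard = (n : ℕ∞)}
    have hA : ∀ n, A n = c ⁻¹' {(n : ℝ≥0∞)} := fun n => by
      ext ω
      simp only [A, hc, mem_ofPred_eq, mem_preimage, mem_singleton_iff,
        Measure.count_apply (Set.to_countable _).measurableSet]
      rw [← ENat.toENNReal_coe, ENat.toENNReal_inj]
    have hAm : ∀ n, MeasurableSet (A n) := fun n => by
      rw [hA]; exact hcm (measurableSet_singleton _)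
    have hdisj : Pairwise (Function.onFun Disjoint A) := fun m n hmn =>
      Set.disjoint_left.2 fun ω h1 h2 => hmn (by
        have : (m : ℕ∞) = n := h1.symm.trans h2
        exact_mod_cast this)
    have hP : ∀ n, P (A n) = poissonMeasure (lam * volume.real (Ico (-(M : ℝ)) M)).toNNReal {n} :=
      fun n => by
        have := h.counts 1 (fun _ => Ico (-(M : ℝ)) M) (fun _ => measurableSet_Ico)
          (fun _ => by simp) (fun i j hij => absurd (Subsingleton.elim i j) hij) (fun _ => n)
        simpa [A] using this
    have hone : P (⋃ n, A n) = 1 := by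
      rw [measure_iUnion hdisj hAm, tsum_congr hP, ← measure_iUnion
        (fun m n hmn => by simpa [Function.onFun] using hmn) fun n => measurableSet_singleton n,
        iUnion_of_singleton]
      exact measure_univ
    have := (prob_compl_eq_zero_iff (MeasurableSet.iUnion hAm)).2 hone
    filter_upwards [compl_mem_ae_iff.2 this] with ω hω
    simp only [compl_compl, mem_iUnion, A, mem_ofPred_eq] at hω
    obtain ⟨n, hn⟩ := hω
    exact finite_of_encard_eq_coe hn
  filter_upwards [ae_all_iff.2 key] with ω hω a b
  obtain ⟨M, hM⟩ := exists_nat_ge (max (-a) b)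
  refine (hω M).subset fun k hk => ⟨?_, ?_⟩
  · linarith [hk.1, (le_max_left (-a) b).trans hM]
  · linarith [hk.2, (le_max_right (-a) b).trans hM]

end

/-! ### Palm distribution of the gaps -/

section

variable {Ω : Type*} [MeasurableSpace Ω] {P : Measure Ω} {X : ℤ → Ω → ℝ} {lam : ℝ}

lemma measurableSet_of_forall_int {S : Set (Ω × ℤ)}
    (hS : ∀ k, MeasurableSet {ω | (ω, k) ∈ S}) : MeasurableSet S := by
  have : S = ⋃ k, {ω | (ω, k) ∈ S} ×ˢ {k} := by
    ext ⟨ω, k⟩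
    simp
  rw [this]
  exact MeasurableSet.iUnion fun k => (hS k).prod (measurableSet_singleton k)

lemma measurableSet_windowChains (h : IsPoissonProcess P X lam) (a b : ℝ) (L : ℕ) (t : ℕ → ℝ)
    (N : ℕ) : MeasurableSet {p : Ω × ℤ | p.2 ∈ windowChains (fun k => X k p.1) a b L t N} := by
  refine measurableSet_of_forall_int fun i => ?_
  have hs : {ω | i ∈ windowChains (fun k => X k ω) a b L t N} =
      {_ω | ⌊a * N⌋ ≤ i ∧ i < ⌊b * N⌋} ∩
        {ω | chain (fun j => ω ∉ emptyCell X N j) L (fun j => ⌈t j * N⌉₊) i} := by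
    ext ω
    simp only [windowChains, emptyCell, mem_ofPred_eq, mem_inter_iff, not_forall, not_not]
  change MeasurableSet {ω | i ∈ windowChains (fun k => X k ω) a b L t N}
  rw [hs]
  exact (MeasurableSet.const _).inter (measurableSet_chain' (h.measurableSet_emptyCell N) _ _ _)

lemma lintegral_count_windowChains [IsProbabilityMeasure P] (h : IsPoissonProcess P X lam)
    (hlam : 0 < lam) (a b : ℝ) (L : ℕ) (t : ℕ → ℝ) {N : ℕ} (hN : 1 ≤ N) :
    ∫⁻ ω, Measure.count (windowChains (fun k => X k ω) a b L t N) ∂P =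
      (⌊b * N⌋ - ⌊a * N⌋).toNat * ((1 - ENNReal.ofReal (Real.exp (-(lam / N)))) *
        ∏ j ∈ Finset.range L, ENNReal.ofReal (Real.exp (-(lam / N))) ^ ⌈t j * N⌉₊) := by
  have hN' : (0 : ℝ) < N := by exact_mod_cast hN
  have hr : ENNReal.ofReal (Real.exp (-(lam / N))) < 1 := by
    rw [ENNReal.ofReal_lt_one, Real.exp_lt_one_iff]
    exact neg_lt_zero.2 (by positivity)
  have hS := measurableSet_windowChains h a b L t N
  have e1 : ∫⁻ ω, Measure.count (windowChains (fun k => X k ω) a b L t N) ∂P =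
      (P.prod Measure.count) {p : Ω × ℤ | p.2 ∈ windowChains (fun k => X k p.1) a b L t N} :=
    (Measure.prod_apply hS).symm
  have e2 : ∀ i ∈ Finset.Ico ⌊a * N⌋ ⌊b * N⌋,
      P ((fun ω => (ω, i)) ⁻¹' {p : Ω × ℤ | p.2 ∈ windowChains (fun k => X k p.1) a b L t N}) =
      (1 - ENNReal.ofReal (Real.exp (-(lam / N)))) *
        ∏ j ∈ Finset.range L, ENNReal.ofReal (Real.exp (-(lam / N))) ^ ⌈t j * N⌉₊ := by
    intro i hi
    rw [← measure_chain (h.measurableSet_emptyCell N) (h.iIndepSet_emptyCell hlam hN) hr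
      (h.measure_emptyCell hlam hN) L (fun j => ⌈t j * N⌉₊) i]
    congr 1
    ext ω
    rw [Finset.mem_Ico] at hi
    simp only [windowChains, emptyCell, mem_ofPred_eq, mem_preimage, not_forall, not_not, hi,
      and_self, true_and]
  rw [e1, Measure.prod_apply_symm hS, lintegral_count,
    tsum_eq_sum (s := Finset.Ico ⌊a * N⌋ ⌊b * N⌋), Finset.sum_congr rfl e2, Finset.sum_const,
    Int.card_Ico, nsmul_eq_mul]
  intro i hi
  rw [Finset.mem_Ico] at hi
  simp [windowChains, hi]

lemma tendsto_floor_mul_div (a : ℝ) :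
    Tendsto (fun N : ℕ => (⌊a * N⌋ : ℝ) / N) atTop (𝓝 a) := by
  have h1 : Tendsto (fun N : ℕ => a - 1 / (N : ℝ)) atTop (𝓝 a) := by
    simpa using (tendsto_const_nhds (x := a)).sub (tendsto_one_div_atTop_nhds_zero_nat (𝕜 := ℝ))
  refine tendsto_of_tendsto_of_tendsto_of_le_of_le' h1 tendsto_const_nhds ?_ ?_
  · filter_upwards [eventually_ge_atTop 1] with N hN
    have hN' : (0 : ℝ) < N := by exact_mod_cast hN
    rw [le_div_iff₀ hN', sub_mul, one_div_mul_cancel hN'.ne']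
    linarith [Int.lt_floor_add_one (a * N)]
  · filter_upwards [eventually_ge_atTop 1] with N hN
    have hN' : (0 : ℝ) < N := by exact_mod_cast hN
    rw [div_le_iff₀ hN']
    exact Int.floor_le _

lemma tendsto_mul_one_sub_exp_neg_div (hlam : 0 < lam) :
    Tendsto (fun N : ℕ => (N : ℝ) * (1 - Real.exp (-(lam / N)))) atTop (𝓝 lam) := by
  have h1 : Tendsto (fun N : ℕ => lam / (1 + lam / (N : ℝ))) atTop (𝓝 lam) := by
    have : Tendsto (fun N : ℕ => 1 + lam / (N : ℝ)) atTop (𝓝 (1 + 0)) :=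
      tendsto_const_nhds.add (tendsto_const_div_atTop_nhds_zero_nat lam)
    have h2 := Tendsto.div (tendsto_const_nhds (x := lam)) this (by norm_num)
    rw [add_zero, div_one] at h2
    exact h2
  refine tendsto_of_tendsto_of_tendsto_of_le_of_le' h1 tendsto_const_nhds ?_ ?_
  · filter_upwards [eventually_ge_atTop 1] with N hN
    have hN' : (0 : ℝ) < N := by exact_mod_cast hN
    have hx : 0 < lam / N := by positivity
    have h2 : Real.exp (-(lam / N)) ≤ 1 / (1 + lam / N) := by
      rw [Real.exp_neg, ← one_div]
      exact one_div_le_one_div_of_le (by positivity) (by linarith [Real.add_one_le_exp (lam / N)])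
    have h3 : lam / (1 + lam / N) = N * (1 - 1 / (1 + lam / N)) := by
      field_simp
      ring
    rw [h3]
    gcongr
  · filter_upwards [eventually_ge_atTop 1] with N hN
    have hN' : (0 : ℝ) < N := by exact_mod_cast hN
    have h2 := Real.add_one_le_exp (-(lam / N))
    calc (N : ℝ) * (1 - Real.exp (-(lam / N))) ≤ N * (lam / N) := by
          gcongr
          linarith
      _ = lam := by field_simp

lemma tendsto_ceil_mul_div (t : ℝ) :
    Tendsto (fun N : ℕ => (⌈t * N⌉₊ : ℝ) / N) atTop (𝓝 (max t 0)) := by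
  rcases le_or_gt 0 t with ht | ht
  · rw [max_eq_left ht]
    exact (tendsto_nat_ceil_mul_div_atTop ht).comp tendsto_natCast_atTop_atTop
  · rw [max_eq_right ht.le]
    have : ∀ N : ℕ, ⌈t * N⌉₊ = 0 := fun N =>
      Nat.ceil_eq_zero.2 (mul_nonpos_of_nonpos_of_nonneg ht.le N.cast_nonneg)
    simp [this]

lemma tendsto_lintegral_count_windowChains [IsProbabilityMeasure P] (h : IsPoissonProcess P X lam)
    (hlam : 0 < lam) {a b : ℝ} (hab : a ≤ b) (L : ℕ) (t : ℕ → ℝ) :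
    Tendsto (fun N : ℕ => ∫⁻ ω, Measure.count (windowChains (fun k => X k ω) a b L t N) ∂P) atTop
      (𝓝 (ENNReal.ofReal (lam * (b - a)) *
        ∏ j ∈ Finset.range L, ENNReal.ofReal (Real.exp (-(lam * max (t j) 0))))) := by
  have hlim : Tendsto (fun N : ℕ => ENNReal.ofReal
      (((⌊b * N⌋ : ℝ) / N - (⌊a * N⌋ : ℝ) / N) * ((N : ℝ) * (1 - Real.exp (-(lam / N)))) *
        ∏ j ∈ Finset.range L, Real.exp (-(lam * ((⌈t j * N⌉₊ : ℝ) / N))))) atTop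
      (𝓝 (ENNReal.ofReal ((b - a) * lam *
        ∏ j ∈ Finset.range L, Real.exp (-(lam * max (t j) 0))))) := by
    refine ENNReal.tendsto_ofReal (Tendsto.mul (Tendsto.mul ?_ ?_) ?_)
    · exact (tendsto_floor_mul_div b).sub (tendsto_floor_mul_div a)
    · exact tendsto_mul_one_sub_exp_neg_div hlam
    · refine tendsto_finsetProd _ fun j _ => ?_
      exact (Real.continuous_exp.tendsto _).comp ((tendsto_ceil_mul_div (t j)).const_mul lam).neg
  have hval : ENNReal.ofReal (lam * (b - a)) *
        ∏ j ∈ Finset.range L, ENNReal.ofReal (Real.exp (-(lam * max (t j) 0))) =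
      ENNReal.ofReal ((b - a) * lam * ∏ j ∈ Finset.range L, Real.exp (-(lam * max (t j) 0))) := by
    rw [← ENNReal.ofReal_prod_of_nonneg fun _ _ => (Real.exp_pos _).le,
      ← ENNReal.ofReal_mul (by nlinarith), mul_comm lam]
  rw [hval]
  refine hlim.congr' ?_
  filter_upwards [eventually_ge_atTop 1] with N hN
  have hN' : (0 : ℝ) < N := by exact_mod_cast hN
  have hfl : ⌊a * N⌋ ≤ ⌊b * N⌋ := Int.floor_mono (by gcongr)
  have hfl' : (0 : ℝ) ≤ (⌊b * N⌋ : ℝ) - ⌊a * N⌋ := sub_nonneg.2 (by exact_mod_cast hfl)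
  have hexp : 0 ≤ 1 - Real.exp (-(lam / N)) := by
    rw [sub_nonneg, Real.exp_le_one_iff]
    exact neg_nonpos.2 (by positivity)
  have hcast : ((⌊b * N⌋ - ⌊a * N⌋).toNat : ℝ≥0∞) = ENNReal.ofReal ((⌊b * N⌋ : ℝ) - ⌊a * N⌋) := by
    rw [← ENNReal.ofReal_natCast]
    congr 1
    have : (((⌊b * N⌋ - ⌊a * N⌋).toNat : ℤ) : ℝ) = ((⌊b * N⌋ - ⌊a * N⌋ : ℤ) : ℝ) := by
      rw [Int.toNat_of_nonneg (by omega)]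
    push_cast at this
    exact_mod_cast this
  have hpow : ∀ j, ENNReal.ofReal (Real.exp (-(lam / N))) ^ ⌈t j * N⌉₊ =
      ENNReal.ofReal (Real.exp (-(lam * ((⌈t j * N⌉₊ : ℝ) / N)))) := fun j => by
    rw [← ENNReal.ofReal_pow (Real.exp_pos _).le, ← Real.exp_nat_mul]
    congr 2
    ring
  rw [lintegral_count_windowChains h hlam a b L t hN, hcast,
    Finset.prod_congr rfl fun j _ => hpow j,
    ← ENNReal.ofReal_prod_of_nonneg fun _ _ => (Real.exp_pos _).le, ← ENNReal.ofReal_one,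
    ← ENNReal.ofReal_sub _ (Real.exp_pos _).le, ← ENNReal.ofReal_mul hexp,
    ← ENNReal.ofReal_mul hfl']
  congr 1
  field_simp

lemma measurableSet_windowPoints (h : IsPoissonProcess P X lam) (a b : ℝ) (L : ℕ) (t : ℕ → ℝ) :
    MeasurableSet {p : Ω × ℤ | p.2 ∈ windowPoints (fun k => X k p.1) a b L t} := by
  refine measurableSet_of_forall_int fun k => ?_
  change MeasurableSet {ω | (a ≤ X k ω ∧ X k ω < b) ∧
    ∀ j < L, t j < X (k + j + 1) ω - X (k + j) ω}
  simp only [ofPred_and, ofPred_forall]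
  refine ((measurableSet_le measurable_const (h.measurable k)).inter
    (measurableSet_lt (h.measurable k) measurable_const)).inter
    (MeasurableSet.iInter fun j => MeasurableSet.iInter fun _ => ?_)
  exact measurableSet_lt measurable_const ((h.measurable _).sub (h.measurable _))

/-- The gaps that follow a point of the Poisson process have, in mean over the points of a window,
independent exponential tails. -/
lemma lintegral_count_windowPoints [IsProbabilityMeasure P] (h : IsPoissonProcess P X lam)
    (hlam : 0 < lam) {a b : ℝ} (hab : a ≤ b) (L : ℕ) (t : ℕ → ℝ) :
    ∫⁻ ω, Measure.count (windowPoints (fun k => X k ω) a b L t) ∂P =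
      ENNReal.ofReal (lam * (b - a)) *
        ∏ j ∈ Finset.range L, ENNReal.ofReal (Real.exp (-(lam * max (t j) 0))) := by
  have hmeas : ∀ a b L t N,
      Measurable fun ω => Measure.count (windowChains (fun k => X k ω) a b L t N) :=
    fun a b L t N => measurable_measure_prodMk_left (measurableSet_windowChains h a b L t N)
  have hlim : ∀ a b L t, ∀ᵐ ω ∂P,
      Tendsto (fun N => Measure.count (windowChains (fun k => X k ω) a b L t N)) atTop
        (𝓝 (Measure.count (windowPoints (fun k => X k ω) a b L t))) := by
    intro a b L t
    filter_upwards [h.strictMono, h.ae_finite_window] with ω h1 h2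
    refine tendsto_const_nhds.congr' ?_
    filter_upwards [eventually_encard_windowChains h1 h2 a b L t] with N hN
    rw [Measure.count_apply .of_discrete, Measure.count_apply .of_discrete, hN]
  -- Fatou's lemma bounds the mean number of points of a window.
  have hbound : ∫⁻ ω, Measure.count (windowPoints (fun k => X k ω) (a - 1) b 0 t) ∂P ≠ ⊤ := by
    refine ne_top_of_le_ne_top ?_ (?_ : _ ≤ ENNReal.ofReal (lam * (b - (a - 1))) *
        ∏ j ∈ Finset.range 0, ENNReal.ofReal (Real.exp (-(lam * max (t j) 0))))
    · simp
    · rw [← (tendsto_lintegral_count_windowChains h hlam (by linarith : a - 1 ≤ b) 0 t).liminf_eq]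
      refine le_trans (le_of_eq (lintegral_congr_ae ?_))
        (lintegral_liminf_le fun N => hmeas _ _ _ _ N)
      filter_upwards [hlim (a - 1) b 0 t] with ω hω
      exact hω.liminf_eq.symm
  have hdom := tendsto_lintegral_of_dominated_convergence
    (F := fun N ω => Measure.count (windowChains (fun k => X k ω) a b L t (N + 1)))
    (fun ω => Measure.count (windowPoints (fun k => X k ω) (a - 1) b 0 t))
    (fun N => hmeas a b L t (N + 1)) (fun N => Eventually.of_forall fun ω => by
      simp only [Measure.count_apply MeasurableSet.of_discrete]
      exact_mod_cast encard_windowChains_le _ a b L t (Nat.le_add_left 1 N))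
    hbound ((hlim a b L t).mono fun ω hω => hω.comp (tendsto_add_atTop_nat 1))
  exact tendsto_nhds_unique hdom
    ((tendsto_lintegral_count_windowChains h hlam hab L t).comp (tendsto_add_atTop_nat 1))

/-- The gaps following point `k`. -/
def gaps (x : ℤ → ℝ) (k : ℤ) (j : ℕ) : ℝ := x (k + j + 1) - x (k + j)

/-- The sets `{g | ∀ j < L, t j < g j}`. -/
def upperBoxes : Set (Set (ℕ → ℝ)) :=
  range fun p : ℕ × (ℕ → ℝ) => {g : ℕ → ℝ | ∀ j < p.1, p.2 j < g j}

lemma isPiSystem_upperBoxes : IsPiSystem upperBoxes := by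
  rintro _ ⟨⟨L, t⟩, rfl⟩ _ ⟨⟨L', t'⟩, rfl⟩ _
  refine ⟨(max L L', fun j => if j < L then if j < L' then max (t j) (t' j) else t j else t' j), ?_⟩
  ext g
  simp only [mem_ofPred_eq, mem_inter_iff]
  constructor
  · intro h
    refine ⟨fun j hj => ?_, fun j hj => ?_⟩ <;> have := h j (by omega) <;> grind
  · rintro ⟨h1, h2⟩ j hj
    have := h1 j
    have := h2 j
    grind

lemma generateFrom_upperBoxes :
    MeasurableSpace.generateFrom upperBoxes = (MeasurableSpace.pi : MeasurableSpace (ℕ → ℝ)) := by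
  refine le_antisymm (MeasurableSpace.generateFrom_le ?_) (iSup_le fun j => ?_)
  · rintro _ ⟨⟨L, t⟩, rfl⟩
    simp only [ofPred_forall]
    exact MeasurableSet.iInter fun j => MeasurableSet.iInter fun _ =>
      measurableSet_lt measurable_const (measurable_pi_apply j)
  · rw [← measurable_iff_comap_le]
    refine @measurable_of_Ioi _ _ _ _ _ (MeasurableSpace.generateFrom upperBoxes) _ _ _ _
      fun t => ?_
    have : (fun g : ℕ → ℝ => g j) ⁻¹' Ioi t =
        ⋃ n : ℕ, {g | ∀ i < j + 1, (if i = j then t else -(n : ℝ)) < g i} := by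
      ext g
      simp only [mem_preimage, mem_Ioi, mem_iUnion, mem_ofPred_eq]
      constructor
      · intro hg
        obtain ⟨n, hn⟩ := exists_nat_gt (∑ i ∈ Finset.range (j + 1), |g i|)
        refine ⟨n, fun i hi => ?_⟩
        split_ifs with hij
        · rwa [hij]
        · have h1 : |g i| ≤ ∑ i ∈ Finset.range (j + 1), |g i| :=
            Finset.single_le_sum (f := fun i => |g i|) (fun i _ => abs_nonneg _) (by simpa using hi)
          linarith [neg_abs_le (g i)]
      · rintro ⟨n, hn⟩
        simpa using hn j (by omega)
    rw [this]
    exact MeasurableSet.iUnion fun n => MeasurableSpace.measurableSet_generateFrom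
      ⟨(j + 1, fun i => if i = j then t else -(n : ℝ)), rfl⟩

lemma expMeasure_Ioi (hlam : 0 < lam) (t : ℝ) :
    expMeasure lam (Ioi t) = ENNReal.ofReal (Real.exp (-(lam * max t 0))) := by
  have := isProbabilityMeasure_expMeasure hlam
  have h1 : (expMeasure lam).real (Iic t) = if 0 ≤ t then 1 - Real.exp (-(lam * t)) else 0 := by
    rw [← cdf_expMeasure_eq hlam, cdf_eq_real]
  have h2 : (expMeasure lam).real (Ioi t) = Real.exp (-(lam * max t 0)) := by
    rw [← compl_Iic, probReal_compl_eq_one_sub measurableSet_Iic, h1]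
    split_ifs with ht
    · rw [max_eq_left ht]; ring
    · rw [max_eq_right (not_le.1 ht).le]; simp
  rw [← h2, ofReal_measureReal]

lemma measurable_gaps (h : IsPoissonProcess P X lam) (k : ℤ) :
    Measurable fun ω => gaps (fun k => X k ω) k :=
  measurable_pi_lambda _ fun _ => (h.measurable _).sub (h.measurable _)

/-- **Palm distribution of a Poisson process**: in mean over the points, the position and the
sequence of gaps that follow are independent, with the intensity measure and i.i.d. exponential
laws. -/
theorem sum_map_position_gaps [IsProbabilityMeasure P] (h : IsPoissonProcess P X lam)
    (hlam : 0 < lam) :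
    Measure.sum (fun k => P.map fun ω => (X k ω, gaps (fun k => X k ω) k)) =
      (ENNReal.ofReal lam • volume : Measure ℝ).prod
        (Measure.infinitePi fun _ : ℕ => expMeasure lam) := by
  have hp := isProbabilityMeasure_expMeasure hlam
  have hC : MeasurableSpace.generateFrom {S | ∃ l u : ℝ, l < u ∧ Ico l u = S} =
      (inferInstance : MeasurableSpace ℝ) :=
    (BorelSpace.measurable_eq.trans (borel_eq_generateFrom_Ico ℝ)).symm
  refine (Measure.prod_eq_generateFrom hC generateFrom_upperBoxes (isPiSystem_Ico id id)
    isPiSystem_upperBoxes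
    { set := fun n => Ico (-((n : ℝ) + 1)) (n + 1)
      set_mem := fun n => ⟨_, _, by linarith [(n.cast_nonneg : (0 : ℝ) ≤ n)], rfl⟩
      finite := fun n => by
        rw [Measure.smul_apply, Real.volume_Ico]
        exact ENNReal.mul_lt_top ENNReal.ofReal_lt_top ENNReal.ofReal_lt_top
      spanning := by
        refine eq_univ_of_forall fun x => mem_iUnion.2 ?_
        obtain ⟨n, hn⟩ := exists_nat_gt |x|
        exact ⟨n, by linarith [neg_abs_le x], by linarith [le_abs_self x]⟩ }
    { set := fun _ => univ
      set_mem := fun _ => ⟨(0, 0), by simp⟩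
      finite := fun _ => by simp
      spanning := iUnion_const _ } ?_).symm
  rintro _ ⟨a, b, hab, rfl⟩ _ ⟨⟨L, t⟩, rfl⟩
  have hbox : {g : ℕ → ℝ | ∀ j < L, t j < g j} = Set.pi (Finset.range L) fun j => Ioi (t j) := by
    ext g
    simp [Set.mem_pi]
  have hD : MeasurableSet {g : ℕ → ℝ | ∀ j < L, t j < g j} := by
    rw [← generateFrom_upperBoxes]
    exact MeasurableSpace.measurableSet_generateFrom ⟨(L, t), rfl⟩
  have hS := measurableSet_windowPoints h a b L t
  have hcount := lintegral_count_windowPoints h hlam hab.le L t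
  have e1 : ∫⁻ ω, Measure.count (windowPoints (fun k => X k ω) a b L t) ∂P =
      (P.prod Measure.count) {p : Ω × ℤ | p.2 ∈ windowPoints (fun k => X k p.1) a b L t} :=
    (Measure.prod_apply hS).symm
  rw [e1, Measure.prod_apply_symm hS, lintegral_count] at hcount
  rw [Measure.sum_apply _ (measurableSet_Ico.prod hD)]
  simp_rw [Measure.map_apply ((h.measurable _).prodMk (measurable_gaps h _))
    (measurableSet_Ico.prod hD)]
  rw [hbox, Measure.infinitePi_pi _ fun _ _ => measurableSet_Ioi, Measure.smul_apply,
    Real.volume_Ico, smul_eq_mul, ← ENNReal.ofReal_mul hlam.le]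
  simp_rw [expMeasure_Ioi hlam]
  rw [← hcount]
  refine tsum_congr fun k => congrArg P ?_
  ext ω
  simp [windowPoints, gaps]

end

/-! ### Campbell's formula for the marked process -/

section

variable {Ω : Type*} [MeasurableSpace Ω] {P : Measure Ω} {X : ℤ → Ω → ℝ} {C : ℤ → Ω → Bool}
  {U : Ω → ℝ} {lamV γ lamR : ℝ}

/-- What is seen from vehicle `k` looking right: its position, the gaps and marks that follow, and
the offset of the road side units. -/
def localData (X : ℤ → Ω → ℝ) (C : ℤ → Ω → Bool) (U : Ω → ℝ) (k : ℤ) (ω : Ω) :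
    ((ℝ × (ℕ → ℝ)) × (ℕ → Bool)) × ℝ :=
  (((X k ω, gaps (fun k => X k ω) k), fun j => C (k + j) ω), U ω)

/-- The law of the gaps, the marks and the offset seen from a typical vehicle: all independent. -/
noncomputable def shapeLaw (P : Measure Ω) (C : ℤ → Ω → Bool) (U : Ω → ℝ) (lamV : ℝ) :
    Measure (((ℕ → ℝ) × (ℕ → Bool)) × ℝ) :=
  ((Measure.infinitePi fun _ => expMeasure lamV).prod
    (Measure.infinitePi fun _ => P.map (C 0))).prod (P.map U)

/-- Invariance of an event under a common translation of vehicles and road side units, and under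
translation of the road side units by their spacing `ℓ`. -/
structure TranslationInvariant (ℓ : ℝ) (R : Set (((ℝ × (ℕ → ℝ)) × (ℕ → Bool)) × ℝ)) : Prop where
  shift : ∀ x g c u s, (((x + s, g), c), u + s) ∈ R ↔ (((x, g), c), u) ∈ R
  periodic : ∀ x g c u, (((x, g), c), u + ℓ) ∈ R ↔ (((x, g), c), u) ∈ R

lemma measurable_localData (h : IsHighway P X C U lamV γ lamR) (k : ℤ) :
    Measurable (localData X C U k) :=
  (((h.poisson.measurable k).prodMk (measurable_gaps h.poisson k)).prodMk
    (measurable_pi_lambda _ fun _ => h.measurable_mark _)).prodMk h.measurable_offset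

lemma map_mark (h : IsHighway P X C U lamV γ lamR) [IsProbabilityMeasure P] (k : ℤ) :
    P.map (C k) = P.map (C 0) := by
  have h1 : ∀ k, P.map (C k) {true} = ENNReal.ofReal γ := fun k => by
    rw [Measure.map_apply (h.measurable_mark k) (measurableSet_singleton _)]
    exact h.mark_prob k
  have hp : ∀ k, IsProbabilityMeasure (P.map (C k)) := fun k =>
    Measure.isProbabilityMeasure_map (h.measurable_mark k).aemeasurable
  have h2 : ∀ k, P.map (C k) {false} = 1 - ENNReal.ofReal γ := fun k => by
    rw [← h1 k, ← prob_compl_eq_one_sub (measurableSet_singleton _)]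
    congr 1
    ext b
    simp
  refine Measure.ext_of_singleton fun b => ?_
  cases b
  · rw [h2, h2]
  · rw [h1, h1]

lemma map_localData (h : IsHighway P X C U lamV γ lamR) [IsProbabilityMeasure P] (k : ℤ) :
    P.map (localData X C U k) =
      ((P.map fun ω => (X k ω, gaps (fun k => X k ω) k)).prod
        (Measure.infinitePi fun _ : ℕ => P.map (C 0))).prod (P.map U) := by
  have hA : Measurable fun x : ℤ → ℝ => (x k, gaps x k) :=
    (measurable_pi_apply k).prodMk (measurable_pi_lambda _ fun _ =>
      (measurable_pi_apply _).sub (measurable_pi_apply _))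
  have hB : Measurable fun (c : ℤ → Bool) (j : ℕ) => c (k + j) :=
    measurable_pi_lambda _ fun _ => measurable_pi_apply _
  have hXm := measurable_pi_lambda (fun ω k => X k ω) h.poisson.measurable
  have hCm := measurable_pi_lambda (fun ω k => C k ω) h.measurable_mark
  have i1 : IndepFun (fun ω => ((X k ω, gaps (fun k => X k ω) k), fun j : ℕ => C (k + j) ω)) U P :=
    h.indep_offset.comp (φ := fun p => ((p.1 k, gaps p.1 k), fun j : ℕ => p.2 (k + j)))
      ((hA.comp measurable_fst).prodMk (hB.comp measurable_snd)) measurable_id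
  have i2 : IndepFun (fun ω => (X k ω, gaps (fun k => X k ω) k)) (fun ω (j : ℕ) => C (k + j) ω) P :=
    h.indep_pos_mark.comp hA hB
  have i3 : iIndepFun (fun (j : ℕ) => C (k + j)) P :=
    h.mark_indep.precomp (g := fun j : ℕ => k + j) fun a b hab => by simpa using hab
  have m1 : Measurable fun ω => (X k ω, gaps (fun k => X k ω) k) := hA.comp hXm
  have m2 : Measurable fun ω (j : ℕ) => C (k + j) ω := hB.comp hCm
  have e3 := i3.map_fun_eq_infinitePi_map fun j => h.measurable_mark _
  have e2 := (indepFun_iff_map_prod_eq_prod_map_map m1.aemeasurable m2.aemeasurable).1 i2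
  have e1 := (indepFun_iff_map_prod_eq_prod_map_map (m1.prodMk m2).aemeasurable
    h.measurable_offset.aemeasurable).1 i1
  simp_rw [map_mark h] at e3
  rw [← e3, ← e2, ← e1]
  rfl

/-- **Campbell's formula**: the mean number of vehicles whose local data lie in `S`. -/
lemma sum_map_localData (h : IsHighway P X C U lamV γ lamR) [IsProbabilityMeasure P]
    (hlamV : 0 < lamV) :
    Measure.sum (fun k => P.map (localData X C U k)) =
      (((ENNReal.ofReal lamV • volume : Measure ℝ).prod
        (Measure.infinitePi fun _ : ℕ => expMeasure lamV)).prod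
        (Measure.infinitePi fun _ : ℕ => P.map (C 0))).prod (P.map U) := by
  have := Measure.isProbabilityMeasure_map (μ := P) (h.measurable_mark 0).aemeasurable
  have := Measure.isProbabilityMeasure_map (μ := P) h.measurable_offset.aemeasurable
  simp_rw [map_localData h]
  rw [← Measure.prod_sum_left, ← Measure.prod_sum_left, sum_map_position_gaps h.poisson hlamV]

lemma cond_Icc_translate {ℓ : ℝ} (hℓ : 0 < ℓ) {A : Set ℝ} (hA : MeasurableSet A)
    (hper : ∀ u, u + ℓ ∈ A ↔ u ∈ A) (x : ℝ) :
    cond volume (Icc 0 ℓ) {u | u - x ∈ A} = cond volume (Icc 0 ℓ) A := by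
  have hinv : ∀ g : AddSubgroup.zmultiples ℓ, (fun u => g +ᵥ u) ⁻¹' A = A := by
    have hn : ∀ n : ℕ, ∀ u, u + n * ℓ ∈ A ↔ u ∈ A := by
      intro n
      induction n with
      | zero => simp
      | succ n ih =>
        intro u
        rw [← ih u, ← hper (u + n * ℓ)]
        push_cast
        ring_nf
    rintro ⟨g, n, rfl⟩
    ext u
    change n • ℓ + u ∈ A ↔ u ∈ A
    rw [zsmul_eq_mul, add_comm]
    obtain ⟨m, rfl | rfl⟩ := n.eq_nat_or_neg
    · exact_mod_cast hn m u
    · rw [← hn m]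
      push_cast
      ring_nf
  have hIcc : ∀ B : Set ℝ, volume (Icc 0 ℓ ∩ B) = volume (B ∩ Ioc 0 (0 + ℓ)) := fun B => by
    rw [inter_comm, zero_add]
    exact measure_congr (Filter.EventuallyEq.inter (ae_eq_refl _) Ioc_ae_eq_Icc.symm)
  rw [cond_apply measurableSet_Icc, cond_apply measurableSet_Icc, hIcc, hIcc]
  congr 1
  have hpre : {u | u - x ∈ A} ∩ Ioc 0 (0 + ℓ) = (fun u => u - x) ⁻¹' (A ∩ Ioc (-x) (-x + ℓ)) := by
    ext u
    simp only [mem_inter_iff, mem_ofPred_eq, mem_Ioc, mem_preimage]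
    constructor
    · rintro ⟨h1, h2, h3⟩
      exact ⟨h1, by linarith, by linarith⟩
    · rintro ⟨h1, h2, h3⟩
      exact ⟨h1, by linarith, by linarith⟩
  rw [hpre, (measurePreserving_sub_right volume x).measure_preimage
    (hA.inter measurableSet_Ioc).nullMeasurableSet]
  exact (isAddFundamentalDomain_Ioc hℓ (-x)).measure_set_eq (isAddFundamentalDomain_Ioc hℓ 0)
    hA hinv

lemma add_sum_gaps (x : ℤ → ℝ) (k : ℤ) (i : ℕ) :
    x k + ∑ j ∈ Finset.range i, gaps x k j = x (k + i) := by
  induction i with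
  | zero => simp
  | succ i ih =>
    rw [Finset.sum_range_succ, ← add_assoc, ih, gaps]
    push_cast
    rw [add_assoc]
    ring_nf

/-- **Stationarity and mass transport**: the mean number of vehicles in `W` whose `i`-th vehicle to
the left sees the translation-invariant event `R` is proportional to the length of `W`, with a
constant that does not depend on `i`. -/
theorem measure_localData_window (h : IsHighway P X C U lamV γ lamR) [IsProbabilityMeasure P]
    (hlamV : 0 < lamV) (hlamR : 0 < lamR) {R : Set (((ℝ × (ℕ → ℝ)) × (ℕ → Bool)) × ℝ)}
    (hR : MeasurableSet R) (hinv : TranslationInvariant lamR⁻¹ R) {W : Set ℝ}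
    (hW : MeasurableSet W) (i : ℕ) :
    (P.prod Measure.count) {p : Ω × ℤ | localData X C U (p.2 - i) p.1 ∈ R ∧ X p.2 p.1 ∈ W} =
      ENNReal.ofReal lamV * volume W *
        shapeLaw P C U lamV {s | (((0, s.1.1), s.1.2), s.2) ∈ R} := by
  have := isProbabilityMeasure_expMeasure hlamV
  have := Measure.isProbabilityMeasure_map (μ := P) (h.measurable_mark 0).aemeasurable
  have := Measure.isProbabilityMeasure_map (μ := P) h.measurable_offset.aemeasurable
  set S : Set (((ℝ × (ℕ → ℝ)) × (ℕ → Bool)) × ℝ) :=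
    R ∩ {z | z.1.1.1 + ∑ j ∈ Finset.range i, z.1.1.2 j ∈ W} with hSdef
  have hsum : Measurable fun z : ℝ × (ℕ → ℝ) => z.1 + ∑ j ∈ Finset.range i, z.2 j := by fun_prop
  have hS : MeasurableSet S :=
    hR.inter (hW.preimage (hsum.comp (measurable_fst.comp measurable_fst)))
  have hmemS : ∀ k ω, localData X C U k ω ∈ S ↔ localData X C U k ω ∈ R ∧ X (k + i) ω ∈ W := by
    intro k ω
    rw [hSdef, mem_inter_iff, mem_ofPred_eq]
    simp only [localData]
    rw [add_sum_gaps (fun k => X k ω) k i]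
  have hset : {p : Ω × ℤ | localData X C U (p.2 - i) p.1 ∈ R ∧ X p.2 p.1 ∈ W} =
      {p | localData X C U (p.2 - i) p.1 ∈ S} := by
    ext p
    rw [mem_ofPred_eq, mem_ofPred_eq, hmemS, sub_add_cancel]
  have hmeas : MeasurableSet {p : Ω × ℤ | localData X C U (p.2 - i) p.1 ∈ S} :=
    measurableSet_of_forall_int fun k => (measurable_localData h (k - i)) hS
  have step1 : (P.prod Measure.count) {p : Ω × ℤ | localData X C U (p.2 - i) p.1 ∈ S} =
      Measure.sum (fun k => P.map (localData X C U k)) S := by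
    rw [Measure.prod_apply_symm hmeas, lintegral_count, Measure.sum_apply _ hS,
      ← (Equiv.subRight (i : ℤ)).tsum_eq fun k => P.map (localData X C U k) S]
    refine tsum_congr fun k => ?_
    rw [Measure.map_apply (measurable_localData h _) hS]
    rfl
  set R₀ : Set (((ℕ → ℝ) × (ℕ → Bool)) × ℝ) := {s | (((0, s.1.1), s.1.2), s.2) ∈ R}
  have hR₀ : MeasurableSet R₀ := by
    refine hR.preimage ?_
    fun_prop
  -- Averaging over the uniform offset removes the dependence on the position.
  have hoff : ∀ x g c, (P.map U) {u | (((x, g), c), u) ∈ R} = (P.map U) {u | ((g, c), u) ∈ R₀} := by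
    intro x g c
    have hU : P.map U = cond volume (Icc 0 lamR⁻¹) := h.offset_uniform
    rw [hU, ← cond_Icc_translate (inv_pos.2 hlamR) (A := {u | ((g, c), u) ∈ R₀})
      (hR₀.preimage measurable_prodMk_left) (fun u => hinv.periodic 0 g c u) x]
    congr 1
    ext u
    have := hinv.shift 0 g c (u - x) x
    rw [zero_add, sub_add_cancel] at this
    exact this
  set w : ℝ × (ℕ → ℝ) → ℝ≥0∞ :=
    fun z => W.indicator 1 (z.1 + ∑ j ∈ Finset.range i, z.2 j) with hw
  have hwm : Measurable w := (measurable_one.indicator hW).comp hsum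
  set ρ : (ℕ → ℝ) × (ℕ → Bool) → ℝ≥0∞ := fun s => (P.map U) {u | (s, u) ∈ R₀} with hρ
  have hρm : Measurable ρ := measurable_measure_prodMk_left hR₀
  have hfib : ∀ z : (ℝ × (ℕ → ℝ)) × (ℕ → Bool),
      (P.map U) (Prod.mk z ⁻¹' S) = w z.1 * ρ (z.1.2, z.2) := by
    rintro ⟨⟨x, g⟩, c⟩
    by_cases hx : x + ∑ j ∈ Finset.range i, g j ∈ W
    · have : Prod.mk ((x, g), c) ⁻¹' S = {u | (((x, g), c), u) ∈ R} := by
        ext u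
        simp [hSdef, hx]
      rw [this, hoff]
      simp [hw, hx, hρ]
    · have : Prod.mk ((x, g), c) ⁻¹' S = ∅ := by
        ext u
        simp [hSdef, hx]
      rw [this]
      simp [hw, hx]
  have hρm' : Measurable fun g => ∫⁻ c, ρ (g, c) ∂Measure.infinitePi fun _ : ℕ => P.map (C 0) :=
    hρm.lintegral_prod_right'
  rw [hset, step1, sum_map_localData h hlamV, Measure.prod_apply hS, lintegral_congr hfib,
    lintegral_prod _ (by fun_prop)]
  have e1 : ∀ z : ℝ × (ℕ → ℝ),
      ∫⁻ c, w z * ρ (z.2, c) ∂(Measure.infinitePi fun _ : ℕ => P.map (C 0)) =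
      w z * ∫⁻ c, ρ (z.2, c) ∂(Measure.infinitePi fun _ : ℕ => P.map (C 0)) := fun z =>
    lintegral_const_mul _ (by fun_prop)
  simp only [e1]
  rw [lintegral_prod_symm _ (by exact (hwm.mul (hρm'.comp measurable_snd)).aemeasurable)]
  have e2 : ∀ g : ℕ → ℝ, ∫⁻ x, w (x, g) ∂(ENNReal.ofReal lamV • volume : Measure ℝ) =
      ENNReal.ofReal lamV * volume W := fun g => by
    have : ∀ x, w (x, g) = ((fun x => x + ∑ j ∈ Finset.range i, g j) ⁻¹' W).indicator 1 x :=
      fun x => rfl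
    simp_rw [this]
    rw [lintegral_indicator_one (hW.preimage (by fun_prop)), Measure.smul_apply,
      measure_preimage_add_right, smul_eq_mul]
  have e3 : ∀ g : ℕ → ℝ, ∫⁻ x, w (x, g) *
      ∫⁻ c, ρ (g, c) ∂(Measure.infinitePi fun _ : ℕ => P.map (C 0))
        ∂(ENNReal.ofReal lamV • volume : Measure ℝ) = ENNReal.ofReal lamV * volume W *
      ∫⁻ c, ρ (g, c) ∂(Measure.infinitePi fun _ : ℕ => P.map (C 0)) := fun g => by
    rw [lintegral_mul_const _ (by fun_prop), e2]
  simp only [e3]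
  rw [lintegral_const_mul _ hρm', shapeLaw, Measure.prod_apply hR₀]
  congr 1
  exact (lintegral_prod ρ hρm.aemeasurable).symm

end

/-! ### Clusters as runs of linked vehicles -/

/-- Consecutive vehicles `j` and `j + 1` of a sequence with gaps `g` and marks `c` are linked. -/
def Linked (d : ℝ) (g : ℕ → ℝ) (c : ℕ → Bool) (j : ℕ) : Prop :=
  c j = true ∧ c (j + 1) = true ∧ g j ≤ d

/-- The vehicles `1, …, n` form a cluster: `1` is capable, consecutive ones are linked, and neither
`0` and `1` nor `n` and `n + 1` are linked. -/
def runSet (d : ℝ) (n : ℕ) : Set ((ℕ → ℝ) × (ℕ → Bool)) :=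
  {s | s.2 1 = true ∧ ¬ Linked d s.1 s.2 0 ∧ (∀ j, 1 ≤ j → j < n → Linked d s.1 s.2 j) ∧
    ¬ Linked d s.1 s.2 n}

/-- Vehicles `k` and `k + 1` are linked. -/
def LinkedAt (d : ℝ) (x : ℤ → ℝ) (c : ℤ → Bool) (k : ℤ) : Prop :=
  c k = true ∧ c (k + 1) = true ∧ x (k + 1) - x k ≤ d

/-- The gaps and marks seen from vehicle `k` looking right. -/
def shape (x : ℤ → ℝ) (c : ℤ → Bool) (k : ℤ) : (ℕ → ℝ) × (ℕ → Bool) :=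
  (gaps x k, fun j => c (k + j))

section

variable {d lamR u : ℝ} {x : ℤ → ℝ} {c : ℤ → Bool}

lemma linked_shape_iff (k : ℤ) (j : ℕ) :
    Linked d (shape x c k).1 (shape x c k).2 j ↔ LinkedAt d x c (k + j) := by
  simp [Linked, LinkedAt, shape, gaps, add_assoc]

lemma shape_mem_runSet_iff (b : ℤ) (n : ℕ) :
    shape x c b ∈ runSet d n ↔ c (b + 1) = true ∧ ¬ LinkedAt d x c b ∧
      (∀ j : ℤ, b < j → j < b + n → LinkedAt d x c j) ∧ ¬ LinkedAt d x c (b + n) := by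
  simp only [runSet, mem_ofPred_eq, linked_shape_iff]
  have h1 : (shape x c b).2 1 = c (b + 1) := by simp [shape]
  rw [h1, Nat.cast_zero, add_zero]
  refine and_congr_right fun _ => and_congr_right fun _ => and_congr_left fun _ => ?_
  constructor
  · intro h j hj1 hj2
    have := h (j - b).toNat (by omega) (by omega)
    rwa [Int.toNat_of_nonneg (by omega), add_sub_cancel] at this
  · exact fun h j hj1 hj2 => h _ (by omega) (by omega)

/-- Between strictly ordered vehicles, links join consecutive vehicles only. -/
lemma linkGraph_adj_iff (hx : StrictMono x) (i j : ℤ) :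
    (linkGraph d x c).Adj i j ↔
      (j = i + 1 ∧ LinkedAt d x c i) ∨ (i = j + 1 ∧ LinkedAt d x c j) := by
  have aux : ∀ {i j : ℤ}, i < j → ((linkGraph d x c).Adj i j ↔ j = i + 1 ∧ LinkedAt d x c i) := by
    intro i j hij
    have hlt := hx hij
    simp only [linkGraph, LinkedAt]
    rw [min_eq_left hlt.le, max_eq_right hlt.le, abs_sub_comm, abs_of_pos (sub_pos.2 hlt)]
    constructor
    · rintro ⟨_, h1, h2, h3, h4⟩
      have hj : j = i + 1 := by
        by_contra hne
        exact h4 (i + 1) ⟨hx (by omega), hx (by omega)⟩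
      subst hj
      exact ⟨rfl, h1, h2, h3⟩
    · rintro ⟨rfl, h1, h2, h3⟩
      refine ⟨hij.ne, h1, h2, h3, fun k ⟨h4, h5⟩ => ?_⟩
      have h6 := hx.lt_iff_lt.1 h4
      have h7 := hx.lt_iff_lt.1 h5
      omega
  rcases lt_trichotomy i j with h | rfl | h
  · rw [aux h]
    exact ⟨Or.inl, fun h' => h'.resolve_right fun h'' => by omega⟩
  · exact iff_of_false (SimpleGraph.irrefl _) (by omega)
  · rw [SimpleGraph.adj_comm, aux h]
    exact ⟨Or.inr, fun h' => h'.resolve_left fun h'' => by omega⟩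

lemma mem_cluster_iff (hx : StrictMono x) (i j : ℤ) :
    j ∈ cluster d x c i ↔ ∀ k, min i j ≤ k → k < max i j → LinkedAt d x c k := by
  constructor
  · rintro ⟨w⟩
    induction w with
    | nil => intro k h1 h2; omega
    | @cons a b e hab w ih =>
      intro k h1 h2
      rcases (linkGraph_adj_iff hx a b).1 hab with ⟨rfl, hl⟩ | ⟨rfl, hl⟩
      · rcases eq_or_ne k a with rfl | hk
        · exact hl
        · exact ih k (by omega) (by omega)
      · rcases eq_or_ne k b with rfl | hk
        · exact hl
        · exact ih k (by omega) (by omega)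
  · have aux : ∀ (n : ℕ) (i : ℤ), (∀ k, i ≤ k → k < i + n → LinkedAt d x c k) →
        (linkGraph d x c).Reachable i (i + n) := by
      intro n
      induction n with
      | zero => intro i _; simp
      | succ n ih =>
        intro i h
        refine (ih i fun k h1 h2 => h k h1 (by push_cast; omega)).trans
          (SimpleGraph.Adj.reachable ?_)
        rw [linkGraph_adj_iff hx]
        exact Or.inl ⟨by push_cast; ring, h _ (by omega) (by push_cast; omega)⟩
    intro h
    rcases le_total i j with hij | hij
    · have := aux (j - i).toNat i fun k h1 h2 => h k (by omega) (by omega)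
      rwa [Int.toNat_of_nonneg (by omega), add_sub_cancel] at this
    · have := aux (i - j).toNat j fun k h1 h2 => h k (by omega) (by omega)
      rw [Int.toNat_of_nonneg (by omega), add_sub_cancel] at this
      exact this.symm

lemma isHead_iff (hx : StrictMono x) (k : ℤ) :
    IsHead d x c k ↔ c k = true ∧ ¬ LinkedAt d x c (k - 1) := by
  refine and_congr_right fun _ => ⟨fun h hl => ?_, fun h j hj => ?_⟩
  · have hmem : k - 1 ∈ cluster d x c k := by
      rw [mem_cluster_iff hx]
      intro l h1 h2
      rwa [show l = k - 1 by omega]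
    exact absurd (hx (by omega : k - 1 < k)) (not_lt.2 (h _ hmem))
  · rw [mem_cluster_iff hx] at hj
    by_contra! hlt
    have := hx.lt_iff_lt.1 hlt
    exact h (hj (k - 1) (by omega) (by omega))

/-- The cluster of the `i`-th vehicle of a run is the run. -/
lemma cluster_eq_of_run (hx : StrictMono x) {k : ℤ} {n i : ℕ} (hi : i < n)
    (h : shape x c (k - (i + 1 : ℕ)) ∈ runSet d n) :
    cluster d x c k = Ico (k - i) (k - i + n) := by
  obtain ⟨_, h2, h3, h4⟩ := (shape_mem_runSet_iff _ _).1 h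
  push_cast at h2 h3 h4
  ext j
  rw [mem_cluster_iff hx, mem_Ico]
  constructor
  · intro hj
    constructor
    · by_contra! hlt
      exact h2 (hj _ (by omega) (by omega))
    · by_contra! hlt
      exact h4 (hj _ (by omega) (by omega))
  · rintro ⟨h5, h6⟩ l h7 h8
    exact h3 l (by omega) (by omega)

lemma capable_of_run {k : ℤ} {n i : ℕ} (hi : i < n)
    (h : shape x c (k - (i + 1 : ℕ)) ∈ runSet d n) : c k = true := by
  obtain ⟨h1, _, h3, _⟩ := (shape_mem_runSet_iff _ _).1 h
  push_cast at h1 h3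
  rcases i.eq_zero_or_pos with rfl | hi0
  · simpa using h1
  · have := (h3 (k - 1) (by omega) (by omega)).2.1
    simpa using this

/-- A vehicle belongs to one run only, at one place. -/
lemma run_unique {k : ℤ} {n i n' i' : ℕ} (hi : i < n) (hi' : i' < n')
    (h : shape x c (k - (i + 1 : ℕ)) ∈ runSet d n)
    (h' : shape x c (k - (i' + 1 : ℕ)) ∈ runSet d n') : n = n' ∧ i = i' := by
  obtain ⟨_, h2, h3, h4⟩ := (shape_mem_runSet_iff _ _).1 h
  obtain ⟨_, h2', h3', h4'⟩ := (shape_mem_runSet_iff _ _).1 h'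
  push_cast at h2 h3 h4 h2' h3' h4'
  have hii : i = i' := by
    rcases lt_trichotomy i i' with hlt | heq | hlt
    · exact absurd (h3' _ (by omega) (by omega)) h2
    · exact heq
    · exact absurd (h3 _ (by omega) (by omega)) h2'
  subst hii
  refine ⟨?_, rfl⟩
  rcases lt_trichotomy n n' with hlt | heq | hlt
  · exact absurd (h3' _ (by omega) (by omega)) h4
  · exact heq
  · exact absurd (h3 _ (by omega) (by omega)) h4'

lemma encard_Ico_int (a : ℤ) (n : ℕ) : (Ico a (a + n)).encard = n := by
  rw [← Finset.coe_Ico, encard_coe_eq_coe_finsetCard, Int.card_Ico]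
  simp

/-- The cluster of a head `k` has `n` vehicles iff `k` starts a run of `n` vehicles. -/
lemma numVehicles_eq_iff_of_head (hx : StrictMono x) {k : ℤ} (hk : c k = true)
    (hl : ¬ LinkedAt d x c (k - 1)) {n : ℕ} (hn : 1 ≤ n) :
    numVehicles d x c k = n ↔ shape x c (k - 1) ∈ runSet d n := by
  classical
  have hcard : ∀ {m : ℕ}, 1 ≤ m → shape x c (k - 1) ∈ runSet d m → numVehicles d x c k = m := by
    intro m hm h
    have hcl := cluster_eq_of_run (i := 0) hx hm (by simpa using h)
    rw [numVehicles, hcl, encard_Ico_int]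
  refine ⟨fun h => ?_, hcard hn⟩
  by_cases hex : ∃ m : ℕ, ¬ LinkedAt d x c (k + m)
  · have hrun : shape x c (k - 1) ∈ runSet d (Nat.find hex + 1) := by
      rw [shape_mem_runSet_iff]
      refine ⟨by simpa using hk, hl, fun j hj1 hj2 => ?_, ?_⟩
      · push_cast at hj2
        have := Nat.find_min hex (m := (j - k).toNat) (by omega)
        rw [not_not, Int.toNat_of_nonneg (by omega), add_sub_cancel] at this
        exact this
      · have := Nat.find_spec hex
        rwa [show k - 1 + ((Nat.find hex + 1 : ℕ) : ℤ) = k + Nat.find hex by push_cast; ring]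
    have h' := hcard (by omega) hrun
    rw [h] at h'
    have h'' : n = Nat.find hex + 1 := by exact_mod_cast h'
    rwa [h'']
  · push Not at hex
    exfalso
    have hsub : Ico k (k + (n + 1 : ℕ)) ⊆ cluster d x c k := by
      rintro j ⟨h1, h2⟩
      rw [mem_cluster_iff hx]
      intro l h3 h4
      have := hex (l - k).toNat
      rwa [Int.toNat_of_nonneg (by omega), add_sub_cancel] at this
    have hle := encard_le_encard hsub
    rw [encard_Ico_int] at hle
    have : ((n + 1 : ℕ) : ℕ∞) ≤ n := hle.trans h.le
    have : n + 1 ≤ n := by exact_mod_cast this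
    omega

lemma one_le_numRSU_iff (k : ℤ) :
    1 ≤ numRSU d lamR x c u k ↔ CoveredV2V d lamR x c u k := by
  rw [numRSU, one_le_encard_iff_nonempty]
  constructor
  · rintro ⟨m, j, hj, hm⟩
    exact ⟨j, hj, m, hm⟩
  · rintro ⟨j, hj, m, hm⟩
    exact ⟨m, j, hj, hm⟩

/-- One of the vehicles `1, …, n` of a sequence is in range of a road side unit. -/
def coverSet (d lamR : ℝ) (n : ℕ) : Set (((ℝ × (ℕ → ℝ)) × (ℕ → Bool)) × ℝ) :=
  {z | ∃ j < n, ∃ m, InRange d lamR z.2 (z.1.1.1 + ∑ l ∈ Finset.range (j + 1), z.1.1.2 l) m}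

lemma coveredV2V_iff_of_run (hx : StrictMono x) {k : ℤ} {n i : ℕ} (hi : i < n)
    (h : shape x c (k - (i + 1 : ℕ)) ∈ runSet d n) :
    CoveredV2V d lamR x c u k ↔
      (((x (k - (i + 1 : ℕ)), gaps x (k - (i + 1 : ℕ))), fun j : ℕ => c (k - (i + 1 : ℕ) + j)), u) ∈
        coverSet d lamR n := by
  have hcl := cluster_eq_of_run hx hi h
  have hmem : ∀ j, (linkGraph d x c).Reachable k j ↔ j ∈ Ico (k - i) (k - i + n) := fun j => by
    rw [← hcl]; rfl
  simp only [CoveredV2V, coverSet, mem_ofPred_eq, hmem, add_sum_gaps]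
  constructor
  · rintro ⟨j, ⟨h1, h2⟩, m, hm⟩
    refine ⟨(j - (k - i)).toNat, by omega, m, ?_⟩
    rwa [show k - ((i + 1 : ℕ) : ℤ) + (((j - (k - i)).toNat + 1 : ℕ) : ℤ) = j by omega]
  · rintro ⟨j, hj, m, hm⟩
    refine ⟨k - ((i + 1 : ℕ) : ℤ) + ((j + 1 : ℕ) : ℤ), ⟨by omega, by omega⟩, m, hm⟩

end

/-! ### The law of the size of a typical cluster -/

/-- The vehicles `a, …, b` are capable and consecutive ones are at distance at most `d`. -/
def linkedBox (d : ℝ) (a b : ℕ) : Set ((ℕ → ℝ) × (ℕ → Bool)) :=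
  (Set.pi (Finset.Ico a b : Finset ℕ) fun _ => Iic d) ×ˢ
    (Set.pi (Finset.Ico a (b + 1) : Finset ℕ) fun _ => {true})

lemma mem_linkedBox_iff {d : ℝ} {a b : ℕ} {s : (ℕ → ℝ) × (ℕ → Bool)} :
    s ∈ linkedBox d a b ↔ (∀ j, a ≤ j → j < b → s.1 j ≤ d) ∧
      ∀ j, a ≤ j → j ≤ b → s.2 j = true := by
  simp [linkedBox, Set.mem_pi]

lemma runSet_eq {d : ℝ} {n : ℕ} (hn : 1 ≤ n) :
    runSet d n = linkedBox d 1 n \ (linkedBox d 0 n ∪ linkedBox d 1 (n + 1)) := by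
  ext ⟨g, c⟩
  simp only [runSet, Linked, Set.mem_sdiff, mem_union, mem_linkedBox_iff, mem_ofPred_eq]
  constructor
  · rintro ⟨h1, h2, h3, h4⟩
    refine ⟨⟨fun j hj hjn => (h3 j hj hjn).2.2, fun j hj hjn => ?_⟩, ?_⟩
    · rcases eq_or_lt_of_le hj with rfl | hj'
      · exact h1
      · have := (h3 (j - 1) (by omega) (by omega)).2.1
        rwa [Nat.sub_add_cancel hj] at this
    · rintro (⟨h5, h6⟩ | ⟨h5, h6⟩)
      · exact h2 ⟨h6 0 le_rfl (by omega), h6 1 (by omega) hn, h5 0 le_rfl (by omega)⟩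
      · exact h4 ⟨h6 n hn (by omega), h6 (n + 1) (by omega) le_rfl, h5 n hn (by omega)⟩
  · rintro ⟨⟨h1, h2⟩, h3⟩
    rw [not_or] at h3
    refine ⟨h2 1 le_rfl hn, fun h => h3.1 ⟨fun j _ hj => ?_, fun j _ hj => ?_⟩,
      fun j hj hjn => ⟨h2 j hj hjn.le, h2 _ (by omega) hjn, h1 j hj hjn⟩,
      fun h => h3.2 ⟨fun j hj hjn => ?_, fun j hj hjn => ?_⟩⟩
    · rcases j.eq_zero_or_pos with rfl | h0
      exacts [h.2.2, h1 j h0 hj]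
    · rcases j.eq_zero_or_pos with rfl | h0
      exacts [h.1, h2 j h0 hj]
    · rcases eq_or_lt_of_le (Nat.lt_succ_iff.1 hjn) with rfl | h0
      exacts [h.2.2, h1 j hj h0]
    · rcases eq_or_lt_of_le hjn with rfl | h0
      exacts [h.2.1, h2 j hj (by omega)]

lemma measurableSet_linkedBox (d : ℝ) (a b : ℕ) : MeasurableSet (linkedBox d a b) :=
  (MeasurableSet.pi (Finset.countable_toSet _) fun _ _ => measurableSet_Iic).prod
    (MeasurableSet.pi (Finset.countable_toSet _) fun _ _ => measurableSet_singleton _)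

lemma measurableSet_runSet (d : ℝ) {n : ℕ} (hn : 1 ≤ n) : MeasurableSet (runSet d n) := by
  rw [runSet_eq hn]
  exact (measurableSet_linkedBox _ _ _).diff
    ((measurableSet_linkedBox _ _ _).union (measurableSet_linkedBox _ _ _))

lemma expMeasure_real_Iic {lam d : ℝ} (hlam : 0 < lam) (hd : 0 ≤ d) :
    (expMeasure lam).real (Iic d) = 1 - Real.exp (-(lam * d)) := by
  have := isProbabilityMeasure_expMeasure hlam
  rw [← cdf_eq_real, cdf_expMeasure_eq hlam, if_pos hd]

section

variable {β : Measure Bool} [IsProbabilityMeasure β] {lam γ d : ℝ}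

lemma measureReal_linkedBox (hlam : 0 < lam) (hd : 0 ≤ d) (hβ : β.real {true} = γ) (a b : ℕ) :
    ((Measure.infinitePi fun _ => expMeasure lam).prod (Measure.infinitePi fun _ => β)).real
      (linkedBox d a b) = (1 - Real.exp (-(lam * d))) ^ (b - a) * γ ^ (b + 1 - a) := by
  have := isProbabilityMeasure_expMeasure hlam
  rw [linkedBox, measureReal_prod_prod, measureReal_def, measureReal_def,
    Measure.infinitePi_pi _ fun _ _ => measurableSet_Iic,
    Measure.infinitePi_pi _ fun _ _ => measurableSet_singleton _, Finset.prod_const,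
    Finset.prod_const, ENNReal.toReal_pow, ENNReal.toReal_pow, ← measureReal_def, ← measureReal_def,
    expMeasure_real_Iic hlam hd, hβ, Nat.card_Ico, Nat.card_Ico]

/-- A vehicle is the left neighbour of a cluster of `n` vehicles with probability
`γ (1 - φ) ^ (n - 1) φ²`: inclusion–exclusion over the two links that bound the cluster. -/
lemma measureReal_runSet (hlam : 0 < lam) (hd : 0 ≤ d) (hβ : β.real {true} = γ) (n : ℕ) :
    ((Measure.infinitePi fun _ => expMeasure lam).prod (Measure.infinitePi fun _ => β)).real
      (runSet d (n + 1)) = γ * (1 - phi lam γ d) ^ n * phi lam γ d ^ 2 := by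
  have := isProbabilityMeasure_expMeasure hlam
  set μ := (Measure.infinitePi fun _ : ℕ => expMeasure lam).prod (Measure.infinitePi fun _ : ℕ => β)
  have hinter : linkedBox d 0 (n + 1) ∩ linkedBox d 1 (n + 1 + 1) = linkedBox d 0 (n + 1 + 1) := by
    ext s
    simp only [mem_inter_iff, mem_linkedBox_iff]
    constructor
    · rintro ⟨⟨h1, h2⟩, h3, h4⟩
      refine ⟨fun j _ hj => ?_, fun j _ hj => ?_⟩
      · rcases j.eq_zero_or_pos with rfl | h0
        exacts [h1 0 le_rfl (by omega), h3 j h0 hj]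
      · rcases j.eq_zero_or_pos with rfl | h0
        exacts [h2 0 le_rfl (by omega), h4 j h0 hj]
    · rintro ⟨h1, h2⟩
      exact ⟨⟨fun j _ hj => h1 j (by omega) (by omega), fun j _ hj => h2 j (by omega) (by omega)⟩,
        fun j _ hj => h1 j (by omega) (by omega), fun j _ hj => h2 j (by omega) (by omega)⟩
  have hsub : linkedBox d 0 (n + 1) ∪ linkedBox d 1 (n + 1 + 1) ⊆ linkedBox d 1 (n + 1) := by
    rintro s (hs | hs) <;> rw [mem_linkedBox_iff] at hs ⊢ <;>
      exact ⟨fun j _ hj => hs.1 j (by omega) (by omega), fun j _ hj => hs.2 j (by omega) (by omega)⟩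
  have hunion := measureReal_union_add_inter (μ := μ) (s := linkedBox d 0 (n + 1))
    (measurableSet_linkedBox d 1 (n + 1 + 1))
  rw [hinter] at hunion
  rw [runSet_eq (by omega), measureReal_sdiff hsub
    ((measurableSet_linkedBox _ _ _).union (measurableSet_linkedBox _ _ _)),
    eq_sub_of_add_eq hunion, measureReal_linkedBox hlam hd hβ, measureReal_linkedBox hlam hd hβ,
    measureReal_linkedBox hlam hd hβ, measureReal_linkedBox hlam hd hβ]
  simp only [phi, Nat.add_sub_cancel, Nat.sub_zero, sub_sub_cancel, mul_pow]
  ring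

end

/-- Every capable vehicle lies in some finite cluster: the run probabilities, weighted by the number
of vehicles, add up to the probability of being capable. -/
lemma hasSum_runSet {lam γ d : ℝ} (hφ0 : 0 < phi lam γ d) (hφ1 : phi lam γ d < 1) :
    HasSum (fun n : ℕ => ((n + 1 : ℕ) : ℝ) * (γ * (1 - phi lam γ d) ^ n * phi lam γ d ^ 2)) γ := by
  have h := (hasSum_choose_mul_geometric_of_norm_lt_one 1
    (show ‖1 - phi lam γ d‖ < 1 by
      rw [Real.norm_eq_abs, abs_lt]; constructor <;> linarith)).mul_left (γ * phi lam γ d ^ 2)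
  simp only [Nat.choose_one_right, sub_sub_cancel] at h
  have h1 : γ * phi lam γ d ^ 2 * (1 / phi lam γ d ^ (1 + 1)) = γ := by field_simp
  rw [h1] at h
  exact h.congr_fun fun n => by ring

lemma phi_pos {lam γ d : ℝ} (hlam : 0 < lam) (hγ0 : 0 < γ) (hγ1 : γ ≤ 1) (hd : 0 < d) :
    0 < phi lam γ d := by
  have h1 := Real.exp_pos (-(lam * d))
  have h2 : Real.exp (-(lam * d)) < 1 := Real.exp_lt_one_iff.2 (neg_lt_zero.2 (mul_pos hlam hd))
  rw [phi]
  nlinarith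

lemma phi_lt_one {lam γ d : ℝ} (hlam : 0 < lam) (hγ0 : 0 < γ) (hd : 0 < d) :
    phi lam γ d < 1 := by
  have h2 : Real.exp (-(lam * d)) < 1 := Real.exp_lt_one_iff.2 (neg_lt_zero.2 (mul_pos hlam hd))
  rw [phi]
  nlinarith

/-! ### Coverage seen from typical clusters and vehicles -/

section

variable {Ω : Type*} [MeasurableSpace Ω] {P : Measure Ω} {X : ℤ → Ω → ℝ} {C : ℤ → Ω → Bool}
  {U : Ω → ℝ} {lamV γ lamR d : ℝ}

/-- The local data of the left neighbour of a cluster of `n` vehicles. -/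
def runEvent (d : ℝ) (n : ℕ) : Set (((ℝ × (ℕ → ℝ)) × (ℕ → Bool)) × ℝ) :=
  {z | (z.1.1.2, z.1.2) ∈ runSet d n}

lemma measurableSet_runEvent (d : ℝ) {n : ℕ} (hn : 1 ≤ n) : MeasurableSet (runEvent d n) :=
  (measurableSet_runSet d hn).preimage (by fun_prop)

lemma measurableSet_inRange (d lamR : ℝ) (m : ℤ) :
    MeasurableSet {p : ℝ × ℝ | InRange d lamR p.1 p.2 m} :=
  measurableSet_le (f := fun p : ℝ × ℝ => |p.2 - (p.1 + m * lamR⁻¹)|) (by fun_prop) measurable_const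

lemma measurableSet_coverSet (d lamR : ℝ) (n : ℕ) : MeasurableSet (coverSet d lamR n) := by
  have : coverSet d lamR n = ⋃ j, ⋃ (_ : j < n), ⋃ m, {z | InRange d lamR z.2
      (z.1.1.1 + ∑ l ∈ Finset.range (j + 1), z.1.1.2 l) m} := by
    ext z
    simp [coverSet]
  rw [this]
  refine MeasurableSet.iUnion fun j => MeasurableSet.iUnion fun _ =>
    MeasurableSet.iUnion fun m => ?_
  exact (measurableSet_inRange d lamR m).preimage
    (f := fun z : ((ℝ × (ℕ → ℝ)) × (ℕ → Bool)) × ℝ =>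
      (z.2, z.1.1.1 + ∑ l ∈ Finset.range (j + 1), z.1.1.2 l)) (by fun_prop)

lemma inRange_add_add (d lamR u y s : ℝ) (m : ℤ) :
    InRange d lamR (u + s) (y + s) m ↔ InRange d lamR u y m := by
  rw [InRange, InRange, rsu, rsu]
  ring_nf

lemma exists_inRange_add_inv (d lamR u y : ℝ) :
    (∃ m, InRange d lamR (u + lamR⁻¹) y m) ↔ ∃ m, InRange d lamR u y m := by
  have : ∀ m : ℤ, InRange d lamR (u + lamR⁻¹) y m ↔ InRange d lamR u y (m + 1) := fun m => by
    rw [InRange, InRange, rsu, rsu]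
    push_cast
    ring_nf
  simp only [this]
  exact ⟨fun ⟨m, hm⟩ => ⟨m + 1, hm⟩, fun ⟨m, hm⟩ => ⟨m - 1, by simpa using hm⟩⟩

lemma translationInvariant_runEvent (d ℓ : ℝ) (n : ℕ) : TranslationInvariant ℓ (runEvent d n) :=
  ⟨fun _ _ _ _ _ => Iff.rfl, fun _ _ _ _ => Iff.rfl⟩

lemma translationInvariant_coverSet (d lamR : ℝ) (n : ℕ) :
    TranslationInvariant lamR⁻¹ (coverSet d lamR n) where
  shift x g c u s := by
    simp only [coverSet, mem_ofPred_eq, add_right_comm _ s, inRange_add_add]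
  periodic x g c u := by
    simp only [coverSet, mem_ofPred_eq, exists_inRange_add_inv]

lemma TranslationInvariant.inter {ℓ : ℝ} {R S : Set (((ℝ × (ℕ → ℝ)) × (ℕ → Bool)) × ℝ)}
    (hR : TranslationInvariant ℓ R) (hS : TranslationInvariant ℓ S) :
    TranslationInvariant ℓ (R ∩ S) :=
  ⟨fun x g c u s => and_congr (hR.shift x g c u s) (hS.shift x g c u s),
    fun x g c u => and_congr (hR.periodic x g c u) (hS.periodic x g c u)⟩

lemma cond_congr_set {α : Type*} [MeasurableSpace α] {μ : Measure α} {s t : Set α}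
    (h : s =ᵐ[μ] t) : cond μ s = cond μ t := by
  rw [ProbabilityTheory.cond, ProbabilityTheory.cond, measure_congr h, Measure.restrict_congr_set h]

/-- The probability that the shape seen from a typical vehicle is that of the left neighbour of a
cluster of `n` vehicles. -/
noncomputable def runProb (P : Measure Ω) (C : ℤ → Ω → Bool) (U : Ω → ℝ) (lamV d : ℝ) (n : ℕ) :
    ℝ≥0∞ :=
  shapeLaw P C U lamV {s | (((0, s.1.1), s.1.2), s.2) ∈ runEvent d n}

/-- The probability that the shape seen from a typical vehicle is that of the left neighbour of a
cluster of `n` vehicles which reaches some road side unit. -/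
noncomputable def coveredRunProb (P : Measure Ω) (C : ℤ → Ω → Bool) (U : Ω → ℝ)
    (lamV d lamR : ℝ) (n : ℕ) : ℝ≥0∞ :=
  shapeLaw P C U lamV {s | (((0, s.1.1), s.1.2), s.2) ∈ runEvent d n ∩ coverSet d lamR n}

namespace IsHighway

lemma isProbabilityMeasure_mark [IsProbabilityMeasure P]
    (h : IsHighway P X C U lamV γ lamR) (k : ℤ) :
    IsProbabilityMeasure (P.map (C k)) :=
  Measure.isProbabilityMeasure_map (h.measurable_mark k).aemeasurable

lemma map_mark_true (h : IsHighway P X C U lamV γ lamR) :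
    P.map (C 0) {true} = ENNReal.ofReal γ := by
  rw [Measure.map_apply (h.measurable_mark 0) (measurableSet_singleton _)]
  exact h.mark_prob 0

lemma isProbabilityMeasure_shapeLaw [IsProbabilityMeasure P]
    (h : IsHighway P X C U lamV γ lamR) (hlamV : 0 < lamV) :
    IsProbabilityMeasure (shapeLaw P C U lamV) := by
  have := isProbabilityMeasure_expMeasure hlamV
  have := h.isProbabilityMeasure_mark 0
  have := Measure.isProbabilityMeasure_map (μ := P) h.measurable_offset.aemeasurable
  rw [shapeLaw]
  infer_instance

lemma toReal_runProb [IsProbabilityMeasure P]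
    (h : IsHighway P X C U lamV γ lamR) (hlamV : 0 < lamV) (hγ0 : 0 < γ)
    (hd : 0 < d) (n : ℕ) :
    (runProb P C U lamV d (n + 1)).toReal = γ * (1 - phi lamV γ d) ^ n * phi lamV γ d ^ 2 := by
  have := isProbabilityMeasure_expMeasure hlamV
  have := h.isProbabilityMeasure_mark 0
  have := Measure.isProbabilityMeasure_map (μ := P) h.measurable_offset.aemeasurable
  have hβ : (P.map (C 0)).real {true} = γ := by
    rw [measureReal_def, h.map_mark_true, ENNReal.toReal_ofReal hγ0.le]
  have hset : {s : ((ℕ → ℝ) × (ℕ → Bool)) × ℝ | (((0, s.1.1), s.1.2), s.2) ∈ runEvent d (n + 1)} =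
      runSet d (n + 1) ×ˢ univ := by
    ext s
    simp [runEvent]
  rw [runProb, shapeLaw, hset, Measure.prod_prod, measure_univ, mul_one, ← measureReal_def,
    measureReal_runSet hlamV hd.le hβ]

lemma ae_strictMono (h : IsHighway P X C U lamV γ lamR) :
    ∀ᵐ p ∂P.prod (Measure.count : Measure ℤ), StrictMono fun k => X k p.1 :=
  Measure.quasiMeasurePreserving_fst.ae h.poisson.strictMono

lemma measurableSet_window (h : IsHighway P X C U lamV γ lamR) {W : Set ℝ} (hW : MeasurableSet W) :
    MeasurableSet {p : Ω × ℤ | X p.2 p.1 ∈ W} :=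
  measurableSet_of_forall_int fun k => h.poisson.measurable k hW

lemma measurableSet_capable (h : IsHighway P X C U lamV γ lamR) :
    MeasurableSet {p : Ω × ℤ | C p.2 p.1 = true} :=
  measurableSet_of_forall_int fun k => h.measurable_mark k (measurableSet_singleton true)

lemma measurableSet_linkedAt (h : IsHighway P X C U lamV γ lamR) (i : ℤ) :
    MeasurableSet {p : Ω × ℤ | LinkedAt d (fun k => X k p.1) (fun k => C k p.1) (p.2 + i)} := by
  refine measurableSet_of_forall_int fun k => ?_
  change MeasurableSet {ω | C (k + i) ω = true ∧ C (k + i + 1) ω = true ∧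
    X (k + i + 1) ω - X (k + i) ω ≤ d}
  simp only [ofPred_and]
  exact (h.measurable_mark _ (measurableSet_singleton true)).inter
    ((h.measurable_mark _ (measurableSet_singleton true)).inter (measurableSet_le
      ((h.poisson.measurable _).sub (h.poisson.measurable _)) measurable_const))

lemma measurableSet_mem_localData (h : IsHighway P X C U lamV γ lamR)
    {R : Set (((ℝ × (ℕ → ℝ)) × (ℕ → Bool)) × ℝ)} (hR : MeasurableSet R) (i : ℕ) :
    MeasurableSet {p : Ω × ℤ | localData X C U (p.2 - i) p.1 ∈ R} :=
  measurableSet_of_forall_int fun k => measurable_localData h (k - i) hR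

lemma measurableSet_localData (h : IsHighway P X C U lamV γ lamR)
    {R : Set (((ℝ × (ℕ → ℝ)) × (ℕ → Bool)) × ℝ)} (hR : MeasurableSet R) {W : Set ℝ}
    (hW : MeasurableSet W) (i : ℕ) :
    MeasurableSet {p : Ω × ℤ | localData X C U (p.2 - i) p.1 ∈ R ∧ X p.2 p.1 ∈ W} :=
  (h.measurableSet_mem_localData hR i).inter (h.measurableSet_window hW)

lemma measure_window_ne_top [IsProbabilityMeasure P]
    (h : IsHighway P X C U lamV γ lamR) (hlamV : 0 < lamV)
    (hlamR : 0 < lamR) {W : Set ℝ} (hW : MeasurableSet W) (hWfin : volume W ≠ ⊤) :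
    (P.prod Measure.count) {p : Ω × ℤ | X p.2 p.1 ∈ W} ≠ ⊤ := by
  have := measure_localData_window h hlamV hlamR MeasurableSet.univ
    ⟨fun _ _ _ _ _ => Iff.rfl, fun _ _ _ _ => Iff.rfl⟩ hW 0
  simp only [mem_univ, true_and] at this
  rw [this]
  have := h.isProbabilityMeasure_shapeLaw hlamV
  finiteness

lemma measure_capable_window [IsProbabilityMeasure P]
    (h : IsHighway P X C U lamV γ lamR) (hlamV : 0 < lamV)
    (hlamR : 0 < lamR) {W : Set ℝ} (hW : MeasurableSet W) :
    (P.prod Measure.count) {p : Ω × ℤ | C p.2 p.1 = true ∧ X p.2 p.1 ∈ W} =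
      ENNReal.ofReal lamV * volume W * ENNReal.ofReal γ := by
  have := isProbabilityMeasure_expMeasure hlamV
  have := h.isProbabilityMeasure_mark 0
  have := Measure.isProbabilityMeasure_map (μ := P) h.measurable_offset.aemeasurable
  have hR : MeasurableSet {z : ((ℝ × (ℕ → ℝ)) × (ℕ → Bool)) × ℝ | z.1.2 0 = true} :=
    (measurableSet_singleton true).preimage
      (f := fun z : ((ℝ × (ℕ → ℝ)) × (ℕ → Bool)) × ℝ => z.1.2 0) (by fun_prop)
  have e := measure_localData_window h hlamV hlamR hR
    ⟨fun _ _ _ _ _ => Iff.rfl, fun _ _ _ _ => Iff.rfl⟩ hW 0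
  have hset : {s : ((ℕ → ℝ) × (ℕ → Bool)) × ℝ | s.1.2 0 = true} =
      (univ ×ˢ Set.pi ({0} : Finset ℕ) fun _ => {true}) ×ˢ univ := by
    ext s
    simp
  simp only [localData, mem_ofPred_eq, Nat.cast_zero, sub_zero, add_zero] at e
  rw [e, shapeLaw, hset, Measure.prod_prod, Measure.prod_prod,
    Measure.infinitePi_pi _ fun _ _ => measurableSet_singleton _]
  simp [h.map_mark_true]

/-- The conditional coverage of a typical cluster of given size is a ratio of run probabilities; in
particular it does not depend on the window. -/
lemma clusterCoverage_eq [IsProbabilityMeasure P]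
    (h : IsHighway P X C U lamV γ lamR) (hlamV : 0 < lamV)
    (hlamR : 0 < lamR) {W : Set ℝ} (hW : MeasurableSet W) (hW0 : volume W ≠ 0)
    (hWfin : volume W ≠ ⊤) {n : ℕ} (hn : 1 ≤ n) :
    clusterCoverage P X C U d lamR W n =
      (coveredRunProb P C U lamV d lamR n).toReal / (runProb P C U lamV d n).toReal := by
  set ν := P.prod (Measure.count : Measure ℤ)
  set S : Set (Ω × ℤ) := {p | (C p.2 p.1 = true ∧
    ¬ LinkedAt d (fun k => X k p.1) (fun k => C k p.1) (p.2 - 1)) ∧ X p.2 p.1 ∈ W} with hSdef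
  set T : Set (Ω × ℤ) := {p | localData X C U (p.2 - (1 : ℕ)) p.1 ∈ runEvent d n}
  have hmono := h.ae_strictMono
  have hSm : MeasurableSet S :=
    (h.measurableSet_capable.inter (h.measurableSet_linkedAt (-1)).compl).inter
      (h.measurableSet_window hW)
  have hTm : MeasurableSet T := h.measurableSet_mem_localData (measurableSet_runEvent d hn) 1
  have hSfin : ν S ≠ ⊤ := ne_top_of_le_ne_top (h.measure_window_ne_top hlamV hlamR hW hWfin)
    (measure_mono fun p hp => hp.2)
  have e1 : {p : Ω × ℤ | IsHead d (fun k => X k p.1) (fun k => C k p.1) p.2 ∧ X p.2 p.1 ∈ W}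
      =ᵐ[ν] S := by
    filter_upwards [hmono] with p hp
    exact propext (and_congr_left fun _ => isHead_iff hp p.2)
  have hac : ∀ᵐ p ∂(cond ν S), p ∈ S ∧ StrictMono fun k => X k p.1 :=
    (ae_cond_mem hSm).and (cond_absolutelyContinuous.ae_le hmono)
  have e2 : {p : Ω × ℤ | numVehicles d (fun k => X k p.1) (fun k => C k p.1) p.2 = (n : ℕ∞)}
      =ᵐ[cond ν S] T := by
    filter_upwards [hac] with p hp
    exact propext (numVehicles_eq_iff_of_head hp.2 hp.1.1.1 hp.1.1.2 hn)
  have hST : S ∩ T = {p | localData X C U (p.2 - (1 : ℕ)) p.1 ∈ runEvent d n ∧ X p.2 p.1 ∈ W} := by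
    ext p
    constructor
    · rintro ⟨h1, h2⟩
      exact ⟨h2, h1.2⟩
    · rintro ⟨h1, h2⟩
      refine ⟨⟨?_, h2⟩, h1⟩
      obtain ⟨h3, h4, _⟩ := (shape_mem_runSet_iff (x := fun k => X k p.1) (c := fun k => C k p.1)
        (p.2 - (1 : ℕ)) n).1 h1
      exact ⟨by simpa using h3, h4⟩
  have hcov : (S ∩ T ∩ {p | 1 ≤ numRSU d lamR (fun k => X k p.1) (fun k => C k p.1) (U p.1) p.2} :
      Set (Ω × ℤ))
      =ᵐ[ν] {p : Ω × ℤ | localData X C U (p.2 - (1 : ℕ)) p.1 ∈ runEvent d n ∩ coverSet d lamR n ∧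
        X p.2 p.1 ∈ W} := by
    rw [hST]
    filter_upwards [hmono] with p hp
    refine propext ?_
    have hiff := fun hrun => (one_le_numRSU_iff (lamR := lamR) (u := U p.1) p.2).trans
      (coveredV2V_iff_of_run (lamR := lamR) (u := U p.1) (c := fun k => C k p.1) (d := d) hp
        (i := 0) (n := n) hn hrun)
    constructor
    · rintro ⟨⟨h1, h2⟩, h3⟩
      exact ⟨⟨h1, (hiff h1).1 h3⟩, h2⟩
    · rintro ⟨⟨h1, h3⟩, h2⟩
      exact ⟨⟨h1, h2⟩, (hiff h1).2 h3⟩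
  have m1 := measure_localData_window h hlamV hlamR (measurableSet_runEvent d hn)
    (translationInvariant_runEvent d _ n) hW 1
  have m2 := measure_localData_window h hlamV hlamR
    ((measurableSet_runEvent d hn).inter (measurableSet_coverSet d lamR n))
    ((translationInvariant_runEvent d _ n).inter (translationInvariant_coverSet d lamR n)) hW 1
  rw [clusterCoverage, typicalCluster, cond_congr_set e1, cond_congr_set e2,
    cond_cond_eq_cond_inter' hSm hTm hSfin, measureReal_def, cond_apply (hSm.inter hTm),
    measure_congr hcov, hST, m1, m2]
  have hpos : (ENNReal.ofReal lamV * volume W).toReal ≠ 0 := by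
    rw [ENNReal.toReal_ne_zero]
    exact ⟨mul_ne_zero (ENNReal.ofReal_pos.2 hlamV).ne' hW0, by finiteness⟩
  generalize ENNReal.ofReal lamV * volume W = κ at hpos ⊢
  rw [ENNReal.toReal_mul, ENNReal.toReal_inv, ENNReal.toReal_mul, ENNReal.toReal_mul, mul_inv,
    mul_mul_mul_comm, inv_mul_cancel₀ hpos, one_mul, ← div_eq_inv_mul]
  rfl

/-- Summing over the places in a cluster: a typical vehicle is covered with the probability obtained
by weighting the covered runs with their number of vehicles. -/
lemma measure_coveredV2V [IsProbabilityMeasure P]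
    (h : IsHighway P X C U lamV γ lamR) (hlamV : 0 < lamV) (hγ0 : 0 < γ)
    (hγ1 : γ ≤ 1) (hlamR : 0 < lamR) (hd : 0 < d) {W : Set ℝ} (hW : MeasurableSet W)
    (hWfin : volume W ≠ ⊤) :
    (P.prod Measure.count) ({p : Ω × ℤ | C p.2 p.1 = true ∧ X p.2 p.1 ∈ W} ∩
      {p | CoveredV2V d lamR (fun k => X k p.1) (fun k => C k p.1) (U p.1) p.2}) =
    ENNReal.ofReal lamV * volume W *
      ∑' n : ℕ, ((n + 1 : ℕ) : ℝ≥0∞) * coveredRunProb P C U lamV d lamR (n + 1) := by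
  have := h.isProbabilityMeasure_shapeLaw hlamV
  set ν := P.prod (Measure.count : Measure ℤ)
  set A : Set (Ω × ℤ) := {p | C p.2 p.1 = true ∧ X p.2 p.1 ∈ W}
  -- `D R q`: the vehicle is at place `q.2` in a cluster of `q.1 + 1` vehicles with property `R`.
  set D : (ℕ → Set (((ℝ × (ℕ → ℝ)) × (ℕ → Bool)) × ℝ)) → (Σ n : ℕ, Fin (n + 1)) → Set (Ω × ℤ) :=
    fun R q => {p | localData X C U (p.2 - (q.2 + 1 : ℕ)) p.1 ∈ runEvent d (q.1 + 1) ∩ R (q.1 + 1) ∧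
      X p.2 p.1 ∈ W} with hD
  have hmeasure : ∀ R : ℕ → Set (((ℝ × (ℕ → ℝ)) × (ℕ → Bool)) × ℝ), (∀ n, MeasurableSet (R n)) →
      (∀ n, TranslationInvariant lamR⁻¹ (R n)) → ν (⋃ q, D R q) = ENNReal.ofReal lamV * volume W *
        ∑' n : ℕ, ((n + 1 : ℕ) : ℝ≥0∞) * shapeLaw P C U lamV
          {s | (((0, s.1.1), s.1.2), s.2) ∈ runEvent d (n + 1) ∩ R (n + 1)} := by
    intro R hRm hRinv
    rw [measure_iUnion]
    · have hq : ∀ q, ν (D R q) = ENNReal.ofReal lamV * volume W * shapeLaw P C U lamV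
          {s | (((0, s.1.1), s.1.2), s.2) ∈ runEvent d (q.1 + 1) ∩ R (q.1 + 1)} := fun q =>
        measure_localData_window h hlamV hlamR
          ((measurableSet_runEvent d (by omega)).inter (hRm _))
          ((translationInvariant_runEvent d _ _).inter (hRinv _)) hW _
      simp_rw [hq]
      rw [ENNReal.tsum_mul_left, ENNReal.tsum_sigma']
      congr 1
      refine tsum_congr fun n => ?_
      have hc : ∀ b : ℝ≥0∞, ∑ _i : Fin (n + 1), b = ((n + 1 : ℕ) : ℝ≥0∞) * b := fun b => by
        rw [Finset.sum_const, Finset.card_univ, Fintype.card_fin, nsmul_eq_mul]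
      rw [tsum_fintype]
      exact hc (shapeLaw P C U lamV
        {s | (((0, s.1.1), s.1.2), s.2) ∈ runEvent d (n + 1) ∩ R (n + 1)})
    · rintro ⟨n, i⟩ ⟨n', i'⟩ hne
      refine Set.disjoint_left.2 fun p hp hp' => hne ?_
      obtain ⟨h1, h2⟩ := run_unique (d := d) (x := fun k => X k p.1) (c := fun k => C k p.1)
        i.2 i'.2 hp.1.1 hp'.1.1
      obtain rfl : n = n' := by omega
      rw [Fin.ext h2]
    · exact fun q => h.measurableSet_localData
        ((measurableSet_runEvent d (by omega)).inter (hRm _)) hW _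
  have hall : ν (⋃ q, D (fun _ => univ) q) = ν A := by
    rw [hmeasure _ (fun _ => MeasurableSet.univ)
      (fun _ => ⟨fun _ _ _ _ _ => Iff.rfl, fun _ _ _ _ => Iff.rfl⟩),
      h.measure_capable_window hlamV hlamR hW]
    congr 1
    have hφ0 := phi_pos hlamV hγ0 hγ1 hd
    have hφ1 := phi_lt_one hlamV hγ0 hd
    have hs := hasSum_runSet hφ0 hφ1
    rw [← hs.tsum_eq, ENNReal.ofReal_tsum_of_nonneg (fun n => ?_) hs.summable]
    · refine tsum_congr fun n => ?_
      rw [← h.toReal_runProb hlamV hγ0 hd n, ENNReal.ofReal_mul (Nat.cast_nonneg _),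
        ENNReal.ofReal_natCast, ENNReal.ofReal_toReal (by rw [runProb]; finiteness)]
      simp only [inter_univ, runProb]
    · have : 0 < 1 - phi lamV γ d := by linarith
      positivity
  have hsub : (⋃ q, D (fun _ => univ) q) ⊆ A := by
    refine iUnion_subset fun q p hp => ⟨?_, hp.2⟩
    exact capable_of_run (d := d) (x := fun k => X k p.1) (c := fun k => C k p.1) q.2.2 hp.1.1
  -- Almost every capable vehicle lies in a finite cluster, as the two means agree.
  have hae : (⋃ q, D (fun _ => univ) q) =ᵐ[ν] A := by
    refine ae_eq_of_subset_of_measure_ge hsub hall.ge ?_ ?_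
    · refine (MeasurableSet.iUnion fun q => h.measurableSet_localData
        ((measurableSet_runEvent d (by omega)).inter MeasurableSet.univ) hW _).nullMeasurableSet
    · rw [h.measure_capable_window hlamV hlamR hW]
      finiteness
  have hcov : (A ∩ {p | CoveredV2V d lamR (fun k => X k p.1) (fun k => C k p.1) (U p.1) p.2} :
      Set (Ω × ℤ))
      =ᵐ[ν] ⋃ q, D (fun n => coverSet d lamR n) q := by
    refine (hae.symm.inter (ae_eq_refl _)).trans ?_
    filter_upwards [h.ae_strictMono] with p hp
    refine propext ?_
    have hiff : ∀ q : Σ n : ℕ, Fin (n + 1), p ∈ D (fun _ => univ) q →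
        (CoveredV2V d lamR (fun k => X k p.1) (fun k => C k p.1) (U p.1) p.2 ↔
          localData X C U (p.2 - (q.2 + 1 : ℕ)) p.1 ∈ coverSet d lamR (q.1 + 1)) := fun q hq =>
      coveredV2V_iff_of_run (lamR := lamR) (u := U p.1) (c := fun k => C k p.1) (d := d) hp
        q.2.2 hq.1.1
    constructor
    · rintro ⟨h1, h2⟩
      obtain ⟨q, hq⟩ := mem_iUnion.1 h1
      exact mem_iUnion.2 ⟨q, ⟨hq.1.1, (hiff q hq).1 h2⟩, hq.2⟩
    · intro h1
      obtain ⟨q, hq⟩ := mem_iUnion.1 h1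
      have hq' : p ∈ D (fun _ => univ) q := ⟨⟨hq.1.1, mem_univ _⟩, hq.2⟩
      exact ⟨mem_iUnion.2 ⟨q, hq'⟩, (hiff q hq').2 hq.1.2⟩
  rw [measure_congr hcov, hmeasure _ (measurableSet_coverSet d lamR)
    (translationInvariant_coverSet d lamR)]
  rfl

lemma isProbabilityMeasure_typicalVehicle [IsProbabilityMeasure P]
    (h : IsHighway P X C U lamV γ lamR) (hlamV : 0 < lamV)
    (hγ0 : 0 < γ) (hlamR : 0 < lamR) {W : Set ℝ} (hW : MeasurableSet W) (hW0 : volume W ≠ 0)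
    (hWfin : volume W ≠ ⊤) : IsProbabilityMeasure (typicalVehicle P X C W) := by
  refine cond_isProbabilityMeasure_of_finite ?_ ?_
  · rw [h.measure_capable_window hlamV hlamR hW]
    exact mul_ne_zero (mul_ne_zero (ENNReal.ofReal_pos.2 hlamV).ne' hW0)
      (ENNReal.ofReal_pos.2 hγ0).ne'
  · rw [h.measure_capable_window hlamV hlamR hW]
    finiteness

lemma measurableSet_capable_window (h : IsHighway P X C U lamV γ lamR) {W : Set ℝ}
    (hW : MeasurableSet W) :
    MeasurableSet {p : Ω × ℤ | C p.2 p.1 = true ∧ X p.2 p.1 ∈ W} :=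
  h.measurableSet_capable.inter (h.measurableSet_window hW)

lemma typicalVehicle_coveredV2V [IsProbabilityMeasure P]
    (h : IsHighway P X C U lamV γ lamR) (hlamV : 0 < lamV)
    (hγ0 : 0 < γ) (hγ1 : γ ≤ 1) (hlamR : 0 < lamR) (hd : 0 < d) {W : Set ℝ} (hW : MeasurableSet W)
    (hW0 : volume W ≠ 0) (hWfin : volume W ≠ ⊤) :
    typicalVehicle P X C W
      {p | CoveredV2V d lamR (fun k => X k p.1) (fun k => C k p.1) (U p.1) p.2} =
    ∑' n : ℕ, (ENNReal.ofReal γ)⁻¹ *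
      (((n + 1 : ℕ) : ℝ≥0∞) * coveredRunProb P C U lamV d lamR (n + 1)) := by
  have hne : ENNReal.ofReal lamV * volume W ≠ 0 :=
    mul_ne_zero (ENNReal.ofReal_pos.2 hlamV).ne' hW0
  have hfin : ENNReal.ofReal lamV * volume W ≠ ⊤ := by finiteness
  rw [typicalVehicle, cond_apply (h.measurableSet_capable_window hW),
    h.measure_coveredV2V hlamV hγ0 hγ1 hlamR hd hW hWfin, h.measure_capable_window hlamV hlamR hW,
    ENNReal.mul_inv (Or.inl hne) (Or.inl hfin), mul_mul_mul_comm, ENNReal.inv_mul_cancel hne hfin,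
    one_mul, ENNReal.tsum_mul_left]

/-- A vehicle at a fixed position is in range of the grid of road side units, whose offset is
uniform, with probability `2 d / lamR⁻¹`. -/
lemma map_offset_inRange (h : IsHighway P X C U lamV γ lamR) (hlamR : 0 < lamR) (hd : 0 < d)
    (hle : 2 * d ≤ lamR⁻¹) :
    P.map U {u | ∃ m, InRange d lamR u 0 m} = ENNReal.ofReal (2 * d * lamR) := by
  have hℓ : 0 < lamR⁻¹ := inv_pos.2 hlamR
  have hU : P.map U = cond volume (Icc 0 lamR⁻¹) := h.offset_uniform
  have hB : MeasurableSet {u | ∃ m, InRange d lamR u 0 m} := by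
    rw [ofPred_exists]
    exact MeasurableSet.iUnion fun m => (measurableSet_inRange d lamR m).preimage
      (f := fun u : ℝ => (u, (0 : ℝ))) (by fun_prop)
  -- Seen from the middle of the interval, only the road side unit `0` matters.
  have hset : Icc 0 lamR⁻¹ ∩ {u | u - lamR⁻¹ / 2 ∈ {u | ∃ m, InRange d lamR u 0 m}} =
      Icc (lamR⁻¹ / 2 - d) (lamR⁻¹ / 2 + d) := by
    ext u
    simp only [mem_inter_iff, mem_Icc, mem_ofPred_eq, InRange, rsu, abs_le]
    constructor
    · rintro ⟨⟨h1, h2⟩, m, h3, h4⟩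
      rcases lt_trichotomy m 0 with hm | rfl | hm
      · have : (m : ℝ) ≤ -1 := by exact_mod_cast (by omega : m ≤ -1)
        constructor <;> nlinarith
      · simp only [Int.cast_zero, zero_mul] at h3 h4
        constructor <;> linarith
      · have : (1 : ℝ) ≤ m := by exact_mod_cast (by omega : 1 ≤ m)
        constructor <;> nlinarith
    · rintro ⟨h1, h2⟩
      refine ⟨⟨by linarith, by linarith⟩, 0, ?_, ?_⟩ <;> simp <;> linarith
  rw [hU, ← cond_Icc_translate hℓ hB (fun u => exists_inRange_add_inv d lamR u 0) (lamR⁻¹ / 2),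
    cond_apply measurableSet_Icc, hset, Real.volume_Icc, Real.volume_Icc, sub_zero,
    ← ENNReal.ofReal_inv_of_pos hℓ, inv_inv, ← ENNReal.ofReal_mul hlamR.le]
  congr 1
  ring

lemma typicalVehicle_coveredV2I [IsProbabilityMeasure P]
    (h : IsHighway P X C U lamV γ lamR) (hlamV : 0 < lamV)
    (hγ0 : 0 < γ) (hlamR : 0 < lamR) (hd : 0 < d) (hle : 2 * d ≤ lamR⁻¹) {W : Set ℝ}
    (hW : MeasurableSet W) (hW0 : volume W ≠ 0) (hWfin : volume W ≠ ⊤) :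
    typicalVehicle P X C W {p | CoveredV2I d lamR (fun k => X k p.1) (U p.1) p.2} =
      ENNReal.ofReal (2 * d * lamR) := by
  have := isProbabilityMeasure_expMeasure hlamV
  have := h.isProbabilityMeasure_mark 0
  have := Measure.isProbabilityMeasure_map (μ := P) h.measurable_offset.aemeasurable
  set R : Set (((ℝ × (ℕ → ℝ)) × (ℕ → Bool)) × ℝ) :=
    {z | z.1.2 0 = true ∧ ∃ m, InRange d lamR z.2 z.1.1.1 m} with hRdef
  have hR : MeasurableSet R := by
    refine MeasurableSet.inter ((measurableSet_singleton true).preimage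
      (f := fun z : ((ℝ × (ℕ → ℝ)) × (ℕ → Bool)) × ℝ => z.1.2 0) (by fun_prop)) ?_
    change MeasurableSet {z : ((ℝ × (ℕ → ℝ)) × (ℕ → Bool)) × ℝ | ∃ m, InRange d lamR z.2 z.1.1.1 m}
    rw [ofPred_exists]
    exact MeasurableSet.iUnion fun m => (measurableSet_inRange d lamR m).preimage
      (f := fun z : ((ℝ × (ℕ → ℝ)) × (ℕ → Bool)) × ℝ => (z.2, z.1.1.1)) (by fun_prop)
  have hinv : TranslationInvariant lamR⁻¹ R :=
    ⟨fun x g c u s => by simp only [hRdef, mem_ofPred_eq, inRange_add_add],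
      fun x g c u => by simp only [hRdef, mem_ofPred_eq, exists_inRange_add_inv]⟩
  have e := measure_localData_window h hlamV hlamR hR hinv hW 0
  have hset : {s : ((ℕ → ℝ) × (ℕ → Bool)) × ℝ | (((0, s.1.1), s.1.2), s.2) ∈ R} =
      (univ ×ˢ Set.pi ({0} : Finset ℕ) fun _ => {true}) ×ˢ {u | ∃ m, InRange d lamR u 0 m} := by
    ext s
    simp [hRdef]
  have hinter : {p : Ω × ℤ | C p.2 p.1 = true ∧ X p.2 p.1 ∈ W} ∩
      {p | CoveredV2I d lamR (fun k => X k p.1) (U p.1) p.2} =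
      {p | localData X C U (p.2 - (0 : ℕ)) p.1 ∈ R ∧ X p.2 p.1 ∈ W} := by
    ext p
    simp only [mem_inter_iff, mem_ofPred_eq, localData, hRdef, CoveredV2I, Nat.cast_zero, sub_zero,
      add_zero]
    tauto
  have hshape : shapeLaw P C U lamV {s | (((0, s.1.1), s.1.2), s.2) ∈ R} =
      ENNReal.ofReal γ * ENNReal.ofReal (2 * d * lamR) := by
    rw [hset, shapeLaw, Measure.prod_prod, Measure.prod_prod,
      Measure.infinitePi_pi _ fun _ _ => measurableSet_singleton _,
      h.map_offset_inRange hlamR hd hle]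
    simp [h.map_mark_true]
  have hne : ENNReal.ofReal lamV * volume W * ENNReal.ofReal γ ≠ 0 :=
    mul_ne_zero (mul_ne_zero (ENNReal.ofReal_pos.2 hlamV).ne' hW0) (ENNReal.ofReal_pos.2 hγ0).ne'
  rw [typicalVehicle, cond_apply (h.measurableSet_capable_window hW), hinter, e, hshape,
    h.measure_capable_window hlamV hlamR hW, ← mul_assoc, ← mul_assoc,
    mul_assoc _ (ENNReal.ofReal lamV * volume W), ENNReal.inv_mul_cancel hne (by finiteness),
    one_mul]

end IsHighway

end

end Highway

theorem lemma2 {Ω : Type*} [MeasurableSpace Ω] (P : MeasureTheory.Measure Ω)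
    [MeasureTheory.IsProbabilityMeasure P]
    (X : ℤ → Ω → ℝ) (C : ℤ → Ω → Bool) (U : Ω → ℝ) (lamV γ lamR d : ℝ)
    (hlamV : 0 < lamV) (hγ0 : 0 < γ) (hγ1 : γ ≤ 1) (hlamR : 0 < lamR) (hd : 0 < d)
    (hmodel : Highway.IsHighway P X C U lamV γ lamR)
    (W W' : Set ℝ) (hW : MeasurableSet W) (hW0 : MeasureTheory.volume W ≠ 0)
    (hWfin : MeasureTheory.volume W ≠ ⊤) (hW' : MeasurableSet W')
    (hW'0 : MeasureTheory.volume W' ≠ 0) (hW'fin : MeasureTheory.volume W' ≠ ⊤) :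
    HasSum (fun n : ℕ => (Highway.phi lamV γ d) ^ 2 *
        (((n + 1 : ℕ) : ℝ) * (1 - Highway.phi lamV γ d) ^ n *
          Highway.clusterCoverage P X C U d lamR W' (n + 1)))
      (Highway.coverageV2V P X C U d lamR W) ∧
    (2 * d ≤ lamR⁻¹ → Highway.coverageV2I P X C U d lamR W = 2 * d * lamR) := by
  have := hmodel.isProbabilityMeasure_typicalVehicle hlamV hγ0 hlamR hW hW0 hWfin
  constructor
  · have hcov := hmodel.typicalVehicle_coveredV2V hlamV hγ0 hγ1 hlamR hd hW hW0 hWfin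
    have hφ0 := Highway.phi_pos hlamV hγ0 hγ1 hd
    have hφ1 : 0 < 1 - Highway.phi lamV γ d := sub_pos.2 (Highway.phi_lt_one hlamV hγ0 hd)
    have hsum := ENNReal.hasSum_toReal (f := fun n : ℕ => (ENNReal.ofReal γ)⁻¹ *
      (((n + 1 : ℕ) : ENNReal) * Highway.coveredRunProb P C U lamV d lamR (n + 1)))
      (by rw [← hcov]; exact MeasureTheory.measure_ne_top _ _)
    rw [← ENNReal.tsum_toReal_eq (ENNReal.ne_top_of_tsum_ne_top
      (by rw [← hcov]; exact MeasureTheory.measure_ne_top _ _)), ← hcov] at hsum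
    refine hsum.congr_fun fun n => ?_
    rw [hmodel.clusterCoverage_eq hlamV hlamR hW' hW'0 hW'fin (by omega),
      hmodel.toReal_runProb hlamV hγ0 hd, ENNReal.toReal_mul, ENNReal.toReal_mul,
      ENNReal.toReal_inv, ENNReal.toReal_ofReal hγ0.le, ENNReal.toReal_natCast]
    field_simp
  · intro hle
    rw [Highway.coverageV2I, MeasureTheory.measureReal_def,
      hmodel.typicalVehicle_coveredV2I hlamV hγ0 hlamR hd hle hW hW0 hWfin,
      ENNReal.toReal_ofReal (by positivity)]
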